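/- There is a universal constant $C>0$ such that the following holds. Let $d_0,n\ge 0$ and $d_1\ge 1$ be integers, let $X\in\mathbb{R}^{d_0\times n}$ be a deterministic matrix with columns $\mathbf{x}_1,\dots,\mathbf{x}_n$, and let $B\ge 0$ be such that $$\sum_{i=1}^n\left(\|\mathbf{x}_i\|^2-1\right)^2\le B^2 .$$ Let $\sigma:\mathbb{R}\to\mathbb{R}$ be $\lambda_\sigma$-Lipschitz with $\mathbb{E}[\sigma(\xi)]=0$ for $\xi\sim\mathcal{N}(0,1)$. Let $W\in\mathbb{R}^{d_1\times d_0}$ be a random matrix with i.i.d. $\mathcal{N}(0,1)$ entries, let $Y=\sigma(WX)\in\mathbb{R}^{d_1\times n}$, where $\sigma$ is applied entrywise, and let $\Phi=\mathbb{E}_{\mathbf{w}}\left[\sigma(\mathbf{w}^\top X)^\top\sigma(\mathbf{w}^\top X)\right]\in\mathbb{R}^{n\times n}$ with $\mathbf{w}\sim\mathcal{N}(0,I_{d_0})$. Then, with probability at least $1-4e^{-2n}$, $$\left\|\frac1{d_1}Y^\top Y-\Phi\right\|\le C\left(\sqrt{\frac n{d_1}}+\frac n{d_1}\right)\lambda_\sigma^2\|X\|^2+32B\lambda_\sigma^2\|X\|\sqrt{\frac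 n{d_1}},$$ where $\|\cdot\|$ is the Euclidean norm of vectors and the spectral norm of matrices. -/

import Mathlib

open MeasureTheory ProbabilityTheory
open scoped Matrix Matrix.Norms.L2Operator NNReal

noncomputable section

/-- The first-layer output `Y = σ(W X)`, with `σ` applied entrywise. -/
def hiddenLayer {d₀ d₁ n : ℕ} (σ : ℝ → ℝ) (W : Matrix (Fin d₁) (Fin d₀) ℝ)
    (X : Matrix (Fin d₀) (Fin n) ℝ) : Matrix (Fin d₁) (Fin n) ℝ :=
  (W * X).map σ

/-- The empirical conjugate kernel `(1 / d₁) Yᵀ Y`. -/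
def empiricalCK {d₀ d₁ n : ℕ} (σ : ℝ → ℝ) (W : Matrix (Fin d₁) (Fin d₀) ℝ)
    (X : Matrix (Fin d₀) (Fin n) ℝ) : Matrix (Fin n) (Fin n) ℝ :=
  (1 / (d₁ : ℝ)) • ((hiddenLayer σ W X)ᵀ * hiddenLayer σ W X)

/-- The standard Gaussian measure on `ℝ^d`: the law of a vector with i.i.d. `N(0,1)` entries. -/
def stdGaussianVec (d : ℕ) : Measure (Fin d → ℝ) :=
  Measure.pi fun _ => gaussianReal 0 1

/-- The expected kernel `Φ = E_w[σ(wᵀ X)ᵀ σ(wᵀ X)]`, `w ∼ N(0, I)`. -/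
def expectedCK {d₀ n : ℕ} (σ : ℝ → ℝ) (X : Matrix (Fin d₀) (Fin n) ℝ) :
    Matrix (Fin n) (Fin n) ℝ :=
  Matrix.of fun i j => ∫ w, σ ((w ᵥ* X) i) * σ ((w ᵥ* X) j) ∂(stdGaussianVec d₀)

/-- The random matrix `W` has i.i.d. `N(0,1)` entries. -/
def IsGaussianWeights {Ω : Type*} [MeasurableSpace Ω] (P : Measure Ω) {d₀ d₁ : ℕ}
    (W : Ω → Matrix (Fin d₁) (Fin d₀) ℝ) : Prop :=
  (∀ i j, HasLaw (fun ω => W ω i j) (gaussianReal 0 1) P) ∧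
    iIndepFun (fun (p : Fin d₁ × Fin d₀) (ω : Ω) => W ω p.1 p.2) P

/-- The Euclidean norm of the `i`-th column of `X`. -/
def colNorm {d₀ n : ℕ} (X : Matrix (Fin d₀) (Fin n) ℝ) (i : Fin n) : ℝ :=
  ‖WithLp.toLp 2 (X.col i)‖

end

/-! The rows of `Y` are i.i.d. copies of the feature vector `y = σ(wᵀX)`, and `w ↦ y` is Lipschitz
with constant `L‖X‖`. By Gaussian concentration (Maurey–Pisier), the centred feature `Z = y - m`, `m
= E y`, is sub-Gaussian in every direction, with variance proxy at most `c‖v‖²` in direction `v`,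
where `c = (8/5 · L‖X‖)²` and `8/5` bounds `π/2`.

Expanding `y = m + Z` in `YᵀY/d₁ - Φ` leaves the deviation of the empirical covariance of `Z`, plus
two rank-one cross terms of total norm at most `(2/d₁)‖m‖‖∑ Z_k‖` (`empiricalCK_sub_expectedCK`).

The covariance term is a Bernstein bound: `⟨v,Z⟩²` is sub-exponential after centring, which gives
`512c(√(n/d₁) + n/d₁)` outside probability `2e^{-2n}`. For the cross term, `‖∑ Z_k‖ < 10√(c n d₁)`
outside probability `e^{-2n}`, and `‖m‖ ≤ L B`: since `E σ(ξ) = 0`, the mean `E σ(sξ)` is at most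
`L|s-1| ≤ L|s²-1|` in absolute value, with `s` a column norm. Then `2 · 10 · 8/5 = 32`, and `512 ·
64/25 ≤ 1311`.

Uniformity over directions uses no net. A norm is comparable to its linear or quadratic form on a
whole small ball of `v`, so its exponential moment is bounded by averaging over a larger ball and
applying Fubini, at the price of a volume ratio `3^n` or `5^n` (`lintegral_le_of_le_on_ball`). -/

/-! ### Gaussian concentration of Lipschitz functions -/

section GaussianConcentration

variable {E : Type*} [NormedAddCommGroup E] [InnerProductSpace ℝ E] [FiniteDimensional ℝ E]
  [MeasurableSpace E] [BorelSpace E]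

/-- The exponential moments of a linear functional under the standard Gaussian measure. -/
theorem lintegral_exp_dual_stdGaussian (ℓ : StrongDual ℝ E) :
    ∫⁻ y, ENNReal.ofReal (Real.exp (ℓ y)) ∂(stdGaussian E) =
      ENNReal.ofReal (Real.exp (‖ℓ‖ ^ 2 / 2)) := by
  have hmap := IsGaussian.map_eq_gaussianReal (μ := stdGaussian E) ℓ
  rw [integral_strongDual_stdGaussian, variance_dual_stdGaussian] at hmap
  have hint : Integrable (fun x : ℝ => Real.exp x) (gaussianReal 0 (‖ℓ‖ ^ 2).toNNReal) := by
    simpa using integrable_exp_mul_gaussianReal (μ := 0) (v := (‖ℓ‖ ^ 2).toNNReal) 1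
  calc ∫⁻ y, ENNReal.ofReal (Real.exp (ℓ y)) ∂(stdGaussian E)
      = ∫⁻ x, ENNReal.ofReal (Real.exp x) ∂((stdGaussian E).map ℓ) := by
        rw [lintegral_map (by fun_prop) (by fun_prop)]
    _ = ENNReal.ofReal (Real.exp (‖ℓ‖ ^ 2 / 2)) := by
        rw [hmap, ← ofReal_integral_eq_lintegral_ofReal hint
          (Filter.Eventually.of_forall fun x => (Real.exp_pos x).le)]
        have := congrFun (mgf_id_gaussianReal (μ := 0) (v := (‖ℓ‖ ^ 2).toNNReal)) 1
        simp only [mgf, id, one_mul] at this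
        rw [this]
        simp

omit [FiniteDimensional ℝ E] [MeasurableSpace E] [BorelSpace E] in
/-- The pathwise step of the Maurey--Pisier argument: interpolate between `x` and `y` along the
quarter circle and apply Jensen's inequality. -/
theorem exp_sub_le_lintegral_rotation {f : E → ℝ} (hf : ContDiff ℝ 1 f) (t : ℝ) (p : E × E) :
    ENNReal.ofReal (Real.exp (t * (f p.2 - f p.1))) ≤
      ENNReal.ofReal (2 / Real.pi) * ∫⁻ θ in Set.Ioc 0 (Real.pi / 2),
        ENNReal.ofReal (Real.exp (Real.pi / 2 * t *
          fderiv ℝ f (ContinuousLinearMap.rotation θ p).1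
            (ContinuousLinearMap.rotation θ p).2)) := by
  have hpi := Real.pi_pos
  set h : ℝ → ℝ := fun θ => fderiv ℝ f (ContinuousLinearMap.rotation θ p).1
            (ContinuousLinearMap.rotation θ p).2 with hh
  have hcont : Continuous h := by
    have h1 := hf.continuous_fderiv one_ne_zero
    simp only [hh, ContinuousLinearMap.rotation_apply]
    fun_prop
  have hderiv : ∀ θ, HasDerivAt (fun θ => f (ContinuousLinearMap.rotation θ p).1) (h θ) θ := by
    intro θ
    have h1 : HasDerivAt (fun θ : ℝ => (ContinuousLinearMap.rotation θ p).1)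
        (ContinuousLinearMap.rotation θ p).2 θ := by
      simp only [ContinuousLinearMap.rotation_apply]
      exact ((Real.hasDerivAt_cos θ).smul_const p.1).add ((Real.hasDerivAt_sin θ).smul_const p.2)
    exact ((hf.differentiable one_ne_zero _).hasFDerivAt).comp_hasDerivAt θ h1
  have hftc : ∫ θ in (0 : ℝ)..(Real.pi / 2), h θ = f p.2 - f p.1 := by
    rw [intervalIntegral.integral_eq_sub_of_hasDerivAt (fun θ _ => hderiv θ)
      (hcont.intervalIntegrable _ _)]
    simp [ContinuousLinearMap.rotation_apply]
  have hvol : volume (Set.Ioc 0 (Real.pi / 2)) = ENNReal.ofReal (Real.pi / 2) := by simp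
  have hcon {g : ℝ → ℝ} (hg : Continuous g) : IntegrableOn g (Set.Ioc 0 (Real.pi / 2)) :=
    hg.integrableOn_Ioc
  -- The factor `π/2` is the length of the interval: it makes the average of the integrand equal `t
  -- (f p.2 - f p.1)`.
  have hjen := ConvexOn.map_set_average_le (μ := volume) (t := Set.Ioc 0 (Real.pi / 2))
    (f := fun θ => Real.pi / 2 * t * h θ) convexOn_exp Real.continuous_exp.continuousOn isClosed_univ
    (by rw [hvol]; simp [hpi]) (by rw [hvol]; simp) (by simp) (hcon (by fun_prop))
    (hcon (by simp only [Function.comp_def]; fun_prop))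
  rw [setAverage_eq, setAverage_eq, ← intervalIntegral.integral_of_le (by positivity),
    intervalIntegral.integral_const_mul, hftc] at hjen
  have hr : volume.real (Set.Ioc 0 (Real.pi / 2)) = Real.pi / 2 := by
    rw [Measure.real, hvol, ENNReal.toReal_ofReal (by positivity)]
  rw [hr, smul_eq_mul, smul_eq_mul] at hjen
  have e1 : (Real.pi / 2)⁻¹ * (Real.pi / 2 * t * (f p.2 - f p.1)) = t * (f p.2 - f p.1) := by
    field_simp
  have e2 : (Real.pi / 2)⁻¹ = 2 / Real.pi := by field_simp
  rw [e1, e2] at hjen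
  refine (ENNReal.ofReal_le_ofReal hjen).trans_eq ?_
  rw [ENNReal.ofReal_mul (by positivity), ofReal_integral_eq_lintegral_ofReal (hcon (by fun_prop))
    (Filter.Eventually.of_forall fun x => (Real.exp_pos _).le)]

theorem measurePreserving_rotation_stdGaussian (θ : ℝ) :
    MeasurePreserving (ContinuousLinearMap.rotation θ : E × E →L[ℝ] E × E)
      ((stdGaussian E).prod (stdGaussian E)) ((stdGaussian E).prod (stdGaussian E)) :=
  ⟨by fun_prop, IsGaussian.map_rotation_eq_self (by simp) θ⟩

/-- The pathwise bound is averaged over the Gaussian pair. A rotated pair has the same law, so every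
angle contributes equally. With the first coordinate fixed, the derivative is a linear functional of
norm at most `K` applied to an independent Gaussian. -/
theorem lintegral_exp_sub_le_of_contDiff {f : E → ℝ} (hf : ContDiff ℝ 1 f) {K : ℝ}
    (hK : ∀ x, ‖fderiv ℝ f x‖ ≤ K) (t : ℝ) :
    ∫⁻ p : E × E, ENNReal.ofReal (Real.exp (t * (f p.2 - f p.1)))
        ∂((stdGaussian E).prod (stdGaussian E)) ≤
      ENNReal.ofReal (Real.exp (Real.pi ^ 2 / 4 * K ^ 2 * t ^ 2 / 2)) := by
  have hpi := Real.pi_pos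
  have h1 := hf.continuous_fderiv one_ne_zero
  set H : E × E → ENNReal := fun p =>
    ENNReal.ofReal (Real.exp (Real.pi / 2 * t * fderiv ℝ f p.1 p.2)) with hH
  have hHm : Measurable H := by
    have : Continuous fun p : E × E => Real.exp (Real.pi / 2 * t * fderiv ℝ f p.1 p.2) := by
      fun_prop
    exact this.measurable.ennreal_ofReal
  have hHr : Measurable fun q : (E × E) × ℝ => H (ContinuousLinearMap.rotation q.2 q.1) := by
    refine hHm.comp ?_
    simp only [ContinuousLinearMap.rotation_apply]
    exact Continuous.measurable (by fun_prop)
  have hHint : ∫⁻ p, H p ∂((stdGaussian E).prod (stdGaussian E)) ≤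
      ENNReal.ofReal (Real.exp (Real.pi ^ 2 / 4 * K ^ 2 * t ^ 2 / 2)) := by
    rw [lintegral_prod _ hHm.aemeasurable]
    have hin : ∀ x, ∫⁻ y, H (x, y) ∂(stdGaussian E) ≤
        ENNReal.ofReal (Real.exp (Real.pi ^ 2 / 4 * K ^ 2 * t ^ 2 / 2)) := by
      intro x
      have := lintegral_exp_dual_stdGaussian ((Real.pi / 2 * t) • fderiv ℝ f x)
      simp only [FunLike.coe_smul, Pi.smul_apply, smul_eq_mul] at this
      simp only [hH]
      rw [this]
      refine ENNReal.ofReal_le_ofReal (Real.exp_le_exp.2 ?_)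
      rw [norm_smul, mul_pow, Real.norm_eq_abs, sq_abs]
      have h2 : ‖fderiv ℝ f x‖ ^ 2 ≤ K ^ 2 := pow_le_pow_left₀ (norm_nonneg _) (hK x) 2
      have h3 : 0 ≤ (Real.pi / 2 * t) ^ 2 := sq_nonneg _
      nlinarith [mul_le_mul_of_nonneg_left h2 h3]
    refine (lintegral_mono hin).trans ?_
    simp
  calc ∫⁻ p : E × E, ENNReal.ofReal (Real.exp (t * (f p.2 - f p.1)))
        ∂((stdGaussian E).prod (stdGaussian E))
      ≤ ∫⁻ p : E × E, (ENNReal.ofReal (2 / Real.pi) * ∫⁻ θ in Set.Ioc 0 (Real.pi / 2),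
        H (ContinuousLinearMap.rotation θ p)) ∂((stdGaussian E).prod (stdGaussian E)) :=
        lintegral_mono fun p => exp_sub_le_lintegral_rotation hf t p
    _ = ENNReal.ofReal (2 / Real.pi) * ∫⁻ θ in Set.Ioc 0 (Real.pi / 2), ∫⁻ p : E × E,
        H (ContinuousLinearMap.rotation θ p) ∂((stdGaussian E).prod (stdGaussian E)) := by
        rw [lintegral_const_mul' _ _ ENNReal.ofReal_ne_top, lintegral_lintegral_swap]
        exact hHr.aemeasurable
    _ = ENNReal.ofReal (2 / Real.pi) * ∫⁻ θ in Set.Ioc 0 (Real.pi / 2), ∫⁻ p : E × E,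
        H p ∂((stdGaussian E).prod (stdGaussian E)) := by
        simp_rw [(measurePreserving_rotation_stdGaussian (E := E) _).lintegral_comp hHm]
    _ = ∫⁻ p, H p ∂((stdGaussian E).prod (stdGaussian E)) := by
        rw [setLIntegral_const, Real.volume_Ioc, mul_comm, mul_assoc,
          ← ENNReal.ofReal_mul (by linarith)]
        have : (Real.pi / 2 - 0) * (2 / Real.pi) = 1 := by field_simp; simp
        rw [this]; simp
    _ ≤ _ := hHint

/-- A Lipschitz function on a finite-dimensional space is a uniform limit of `C¹` functions whose
derivative is bounded by the Lipschitz constant. -/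
theorem LipschitzWith.exists_contDiff_approx {f : E → ℝ} {K : ℝ≥0} (hf : LipschitzWith K f)
    {ε : ℝ} (hε : 0 < ε) :
    ∃ g : E → ℝ, ContDiff ℝ 1 g ∧ (∀ x, ‖fderiv ℝ g x‖ ≤ K) ∧ ∀ x, |g x - f x| ≤ ε := by
  -- Mollification at this radius moves `f` by at most `ε`; `K + 1` replaces `K` to allow `K = 0`.
  have hpos : 0 < ε / (K + 1) := by positivity
  let φ : ContDiffBump (0 : E) := ⟨ε / (K + 1) / 2, ε / (K + 1), by positivity, by linarith⟩
  let g : E → ℝ := convolution (φ.normed volume) f (ContinuousLinearMap.lsmul ℝ ℝ) volume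
  have hfc := hf.continuous
  have hsm : ContDiff ℝ (1 : ℕ∞) g :=
    (φ.hasCompactSupport_normed (μ := volume)).contDiff_convolution_left _ φ.contDiff_normed
      (hfc.locallyIntegrable (μ := volume))
  have hex : ConvolutionExists (φ.normed volume) f (ContinuousLinearMap.lsmul ℝ ℝ) volume :=
    (φ.hasCompactSupport_normed (μ := volume)).convolutionExists_left _ (φ.continuous_normed)
      (hfc.locallyIntegrable (μ := volume))
  have hlip : LipschitzWith K g := by
    refine LipschitzWith.of_dist_le_mul fun x y => ?_
    have hx := hex x
    have hy := hex y
    simp only [ConvolutionExistsAt, ContinuousLinearMap.lsmul_apply] at hx hy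
    rw [Real.dist_eq]
    simp only [g, convolution_def, ContinuousLinearMap.lsmul_apply]
    rw [← integral_sub hx hy]
    calc |∫ a, (φ.normed volume a • f (x - a) - φ.normed volume a • f (y - a))|
        ≤ ∫ a, φ.normed volume a * (K * dist x y) := by
          have hi : Integrable (fun a => φ.normed volume a * (K * dist x y)) :=
            φ.integrable_normed.mul_const _
          rw [← Real.norm_eq_abs]
          refine norm_integral_le_of_norm_le hi
            (Filter.Eventually.of_forall fun a => ?_)
          rw [← smul_sub, norm_smul, Real.norm_of_nonneg (φ.nonneg_normed a)]
          refine mul_le_mul_of_nonneg_left ?_ (φ.nonneg_normed a)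
          have := hf.dist_le_mul (x - a) (y - a)
          rwa [Real.dist_eq, dist_sub_right] at this
      _ = K * dist x y := by rw [integral_mul_const, φ.integral_normed, one_mul]
  refine ⟨g, by exact_mod_cast hsm, fun x => norm_fderiv_le_of_lipschitz ℝ hlip, fun x => ?_⟩
  have := ContDiffBump.dist_normed_convolution_le (φ := φ) (μ := volume) (g := f) (x₀ := x) (ε := ε)
    hfc.aestronglyMeasurable (fun y hy => by
      have h1 : dist y x < ε / (K + 1) := hy
      calc dist (f y) (f x) ≤ K * dist y x := hf.dist_le_mul y x
        _ ≤ (K + 1) * (ε / (K + 1)) := by gcongr; linarith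
        _ = ε := by field_simp)
  rwa [Real.dist_eq] at this

/-- A uniform `ε`-approximation by `C¹` functions changes the exponent by at most `2ε|t|`; then `ε →
0`. -/
theorem lintegral_exp_sub_le_of_lipschitzWith {f : E → ℝ} {K : ℝ≥0} (hf : LipschitzWith K f)
    (t : ℝ) :
    ∫⁻ p : E × E, ENNReal.ofReal (Real.exp (t * (f p.2 - f p.1)))
        ∂((stdGaussian E).prod (stdGaussian E)) ≤
      ENNReal.ofReal (Real.exp (Real.pi ^ 2 / 4 * K ^ 2 * t ^ 2 / 2)) := by
  set M := Real.pi ^ 2 / 4 * (K : ℝ) ^ 2 * t ^ 2 / 2 with hM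
  have key : ∀ ε > 0, ∫⁻ p : E × E, ENNReal.ofReal (Real.exp (t * (f p.2 - f p.1)))
        ∂((stdGaussian E).prod (stdGaussian E)) ≤
      ENNReal.ofReal (Real.exp (|t| * (2 * ε) + M)) := by
    intro ε hε
    obtain ⟨g, hg, hgK, hgf⟩ := hf.exists_contDiff_approx hε
    have hb := lintegral_exp_sub_le_of_contDiff hg hgK t
    rw [Real.exp_add, ENNReal.ofReal_mul (Real.exp_pos _).le]
    refine le_trans ?_ (mul_le_mul_right hb _)
    rw [← lintegral_const_mul' _ _ ENNReal.ofReal_ne_top]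
    refine lintegral_mono fun p => ?_
    rw [← ENNReal.ofReal_mul (Real.exp_pos _).le, ← Real.exp_add]
    refine ENNReal.ofReal_le_ofReal (Real.exp_le_exp.2 ?_)
    have h1 : |(f p.2 - f p.1) - (g p.2 - g p.1)| ≤ 2 * ε := by
      have a1 := abs_le.1 (hgf p.1)
      have a2 := abs_le.1 (hgf p.2)
      rw [abs_le]; constructor <;> linarith
    have h2 : t * ((f p.2 - f p.1) - (g p.2 - g p.1)) ≤ |t| * (2 * ε) :=
      (le_abs_self _).trans (by rw [abs_mul]; gcongr)
    linarith
  have hlim : Filter.Tendsto (fun ε : ℝ => ENNReal.ofReal (Real.exp (|t| * (2 * ε) + M)))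
      (nhdsWithin 0 (Set.Ioi 0)) (nhds (ENNReal.ofReal (Real.exp M))) := by
    have : Continuous fun ε : ℝ => ENNReal.ofReal (Real.exp (|t| * (2 * ε) + M)) :=
      ENNReal.continuous_ofReal.comp (by fun_prop)
    have := this.tendsto 0
    simp only [mul_zero, zero_add] at this
    exact this.mono_left nhdsWithin_le_nhds
  exact ge_of_tendsto hlim (by filter_upwards [self_mem_nhdsWithin] with ε hε using key ε hε)

/-- **Gaussian concentration** (with the Maurey--Pisier constant): a Lipschitz function of a standard
Gaussian vector is sub-Gaussian around its mean. -/
theorem LipschitzWith.hasSubgaussianMGF_stdGaussian {f : E → ℝ} {K : ℝ≥0}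
    (hf : LipschitzWith K f) {c : ℝ≥0} (hc : Real.pi ^ 2 / 4 * (K : ℝ) ^ 2 ≤ c) :
    HasSubgaussianMGF (fun x => f x - ∫ y, f y ∂(stdGaussian E)) c (stdGaussian E) := by
  have hfc := hf.continuous
  have hbound (t : ℝ) := lintegral_exp_sub_le_of_lipschitzWith hf t
  have hsplit (t : ℝ) : ∫⁻ p : E × E, ENNReal.ofReal (Real.exp (t * (f p.2 - f p.1)))
        ∂((stdGaussian E).prod (stdGaussian E)) =
      (∫⁻ x, ENNReal.ofReal (Real.exp (-t * f x)) ∂(stdGaussian E)) *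
        ∫⁻ x, ENNReal.ofReal (Real.exp (t * f x)) ∂(stdGaussian E) := by
    rw [← lintegral_prod_mul (by fun_prop) (by fun_prop)]
    refine lintegral_congr fun p => ?_
    rw [← ENNReal.ofReal_mul (Real.exp_pos _).le, ← Real.exp_add]
    ring_nf
  have hne (t : ℝ) : ∫⁻ x, ENNReal.ofReal (Real.exp (t * f x)) ∂(stdGaussian E) ≠ 0 := by
    rw [Ne, lintegral_eq_zero_iff (by fun_prop)]
    intro h
    have : ∀ᵐ x ∂(stdGaussian E), False := by
      filter_upwards [h] with x hx
      simp only [Pi.zero_apply, ENNReal.ofReal_eq_zero] at hx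
      exact absurd (Real.exp_pos _) (not_lt.2 hx)
    simp [ae_iff] at this
  -- The product of the moments at `t` and `-t` is finite and neither vanishes, so both are finite;
  -- integrability of `f` is a consequence.
  have hfin (t : ℝ) : ∫⁻ x, ENNReal.ofReal (Real.exp (t * f x)) ∂(stdGaussian E) ≠ ⊤ := by
    intro h
    have := hbound t
    rw [hsplit, h, ENNReal.mul_top (hne _)] at this
    exact absurd this (by simp)
  have hint (t : ℝ) : Integrable (fun x => Real.exp (t * f x)) (stdGaussian E) :=
    (lintegral_ofReal_ne_top_iff_integrable (by fun_prop)
      (Filter.Eventually.of_forall fun x => (Real.exp_pos _).le)).1 (hfin t)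
  have hfint : Integrable f (stdGaussian E) :=
    (integrable_pow_of_integrable_exp_mul one_ne_zero (hint 1) (hint (-1)) 1).congr
      (Filter.Eventually.of_forall fun x => pow_one _)
  set m := ∫ y, f y ∂(stdGaussian E) with hm
  have hexp (t : ℝ) : (fun x => Real.exp (t * (f x - m))) =
      fun x => Real.exp (-t * m) * Real.exp (t * f x) := by
    ext x; rw [← Real.exp_add]; ring_nf
  refine ⟨fun t => by rw [hexp]; exact (hint t).const_mul _, fun t => ?_⟩
  -- Jensen replaces the mean by an independent copy of the variable, reducing the claim to the
  -- two-point bound.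
  have hjen : Real.exp (-t * m) ≤ ∫ x, Real.exp (-t * f x) ∂(stdGaussian E) := by
    have := ConvexOn.map_integral_le (μ := stdGaussian E) (f := fun x => -t * f x) convexOn_exp
      Real.continuous_exp.continuousOn isClosed_univ (by simp) (hfint.const_mul _) (hint _)
    rwa [integral_const_mul] at this
  rw [mgf, hexp, integral_const_mul]
  have hb := hbound t
  rw [hsplit, ← ofReal_integral_eq_lintegral_ofReal (hint _)
      (Filter.Eventually.of_forall fun x => (Real.exp_pos _).le),
      ← ofReal_integral_eq_lintegral_ofReal (hint _)
      (Filter.Eventually.of_forall fun x => (Real.exp_pos _).le),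
      ← ENNReal.ofReal_mul (integral_nonneg fun x => (Real.exp_pos _).le),
      ENNReal.ofReal_le_ofReal_iff (Real.exp_pos _).le] at hb
  calc Real.exp (-t * m) * ∫ x, Real.exp (t * f x) ∂(stdGaussian E)
      ≤ (∫ x, Real.exp (-t * f x) ∂(stdGaussian E)) * ∫ x, Real.exp (t * f x) ∂(stdGaussian E) :=
        mul_le_mul_of_nonneg_right hjen (integral_nonneg fun x => (Real.exp_pos _).le)
    _ ≤ _ := hb
    _ ≤ _ := by gcongr

end GaussianConcentration

/-! ### Squares of sub-Gaussian variables -/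

section SquareOfSubgaussian

theorem lintegral_exp_mul_gaussianReal (t : ℝ) :
    ∫⁻ g, ENNReal.ofReal (Real.exp (t * g)) ∂(gaussianReal 0 1) =
      ENNReal.ofReal (Real.exp (t ^ 2 / 2)) := by
  rw [← ofReal_integral_eq_lintegral_ofReal (integrable_exp_mul_gaussianReal t)
    (Filter.Eventually.of_forall fun x => (Real.exp_pos _).le)]
  have := congrFun (mgf_id_gaussianReal (μ := 0) (v := 1)) t
  simp only [mgf, id] at this
  rw [this]
  simp

theorem lintegral_exp_sq_gaussianReal :
    ∫⁻ g, ENNReal.ofReal (Real.exp (g ^ 2 / 4)) ∂(gaussianReal 0 1) = ENNReal.ofReal √2 := by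
  rw [gaussianReal_of_var_ne_zero _ one_ne_zero,
    lintegral_withDensity_eq_lintegral_mul _ (measurable_gaussianPDF _ _) (by fun_prop)]
  have h : ∀ x : ℝ, (gaussianPDF 0 1 * fun g => ENNReal.ofReal (Real.exp (g ^ 2 / 4))) x =
      ENNReal.ofReal ((√(2 * Real.pi))⁻¹ * Real.exp (-(1 / 4) * x ^ 2)) := by
    intro x
    simp only [Pi.mul_apply, gaussianPDF, gaussianPDFReal]
    rw [← ENNReal.ofReal_mul (by positivity), mul_assoc, ← Real.exp_add]
    congr 2
    · simp
    · congr 1; simp; ring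
  simp_rw [h]
  rw [← ofReal_integral_eq_lintegral_ofReal
    ((integrable_exp_neg_mul_sq (by norm_num)).const_mul _)
    (Filter.Eventually.of_forall fun x => by positivity), integral_const_mul, integral_gaussian]
  congr 1
  have hpi := Real.pi_pos
  rw [← Real.sqrt_inv, ← Real.sqrt_mul (by positivity)]
  congr 1
  field_simp
  norm_num

variable {Ω : Type*} [MeasurableSpace Ω] {μ : Measure Ω} {X : Ω → ℝ} {c : ℝ≥0}

theorem ProbabilityTheory.HasSubgaussianMGF.lintegral_exp_mul_le (h : HasSubgaussianMGF X c μ) (t : ℝ) :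
    ∫⁻ ω, ENNReal.ofReal (Real.exp (t * X ω)) ∂μ ≤
      ENNReal.ofReal (Real.exp (c * t ^ 2 / 2)) := by
  rw [← ofReal_integral_eq_lintegral_ofReal (h.integrable_exp_mul t)
    (Filter.Eventually.of_forall fun x => (Real.exp_pos _).le)]
  exact ENNReal.ofReal_le_ofReal (h.mgf_le t)

/-- The square is linearised by an auxiliary Gaussian: `exp(s²X²/2)` is the mean of `exp(sXg)` over
`g`. After Fubini the sub-Gaussian bound in `X` leaves a Gaussian integral. -/
theorem ProbabilityTheory.HasSubgaussianMGF.lintegral_exp_sq_le [SFinite μ] (h : HasSubgaussianMGF X c μ)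
    (hc : 0 < c) :
    ∫⁻ ω, ENNReal.ofReal (Real.exp (X ω ^ 2 / (4 * c))) ∂μ ≤ ENNReal.ofReal √2 := by
  have hX := h.aemeasurable
  have hc' : (0 : ℝ) < c := hc
  -- With `s² = 1/(2c)` the exponent is `X²/(4c)` before the swap and at most `g²/4` after it.
  set s : ℝ := (√(2 * c))⁻¹ with hs
  have hs2 : s ^ 2 = 1 / (2 * c) := by
    rw [hs, inv_pow, Real.sq_sqrt (by positivity), one_div]
  calc ∫⁻ ω, ENNReal.ofReal (Real.exp (X ω ^ 2 / (4 * c))) ∂μ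
      = ∫⁻ ω, ∫⁻ g, ENNReal.ofReal (Real.exp ((s * X ω) * g)) ∂(gaussianReal 0 1) ∂μ := by
        refine lintegral_congr fun ω => ?_
        rw [lintegral_exp_mul_gaussianReal, mul_pow, hs2]
        congr 2
        field_simp
        norm_num
    _ = ∫⁻ g, ∫⁻ ω, ENNReal.ofReal (Real.exp ((s * g) * X ω)) ∂μ ∂(gaussianReal 0 1) := by
        rw [lintegral_lintegral_swap]
        · simp_rw [mul_right_comm]
        · have h1 : AEMeasurable (fun p : Ω × ℝ => X p.1) (μ.prod (gaussianReal 0 1)) :=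
            hX.comp_quasiMeasurePreserving Measure.quasiMeasurePreserving_fst
          have h2 : Measurable fun p : Ω × ℝ => p.2 := measurable_snd
          simp only [Function.uncurry_def]
          fun_prop
    _ ≤ ∫⁻ g, ENNReal.ofReal (Real.exp (g ^ 2 / 4)) ∂(gaussianReal 0 1) := by
        refine lintegral_mono fun g => (h.lintegral_exp_mul_le _).trans_eq ?_
        rw [mul_pow, hs2]
        congr 2
        field_simp
        ring
    _ = _ := lintegral_exp_sq_gaussianReal

theorem Real.exp_le_one_add_add_sq_mul_exp (x : ℝ) :
    Real.exp x ≤ 1 + x + x ^ 2 * Real.exp |x| := by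
  have := Complex.norm_exp_sub_sum_le_norm_mul_exp (x : ℂ) 2
  simp only [Finset.sum_range_succ, Finset.range_zero, Finset.sum_empty, pow_zero, Nat.factorial,
    pow_one] at this
  norm_num at this
  have h2 : Complex.exp x - (1 + x) = ((Real.exp x - (1 + x) : ℝ) : ℂ) := by push_cast; rfl
  rw [h2, Complex.norm_real, Real.norm_eq_abs] at this
  have := (le_abs_self _).trans this
  linarith

/-- The centred square of a sub-Gaussian variable is sub-exponential. -/
theorem ProbabilityTheory.HasSubgaussianMGF.lintegral_exp_centred_sq_le [IsProbabilityMeasure μ]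
    (h : HasSubgaussianMGF X c μ) (hc : 0 < c) {t : ℝ} (ht : |t| ≤ 1 / (8 * c)) :
    ∫⁻ ω, ENNReal.ofReal (Real.exp (t * (X ω ^ 2 - ∫ ω', X ω' ^ 2 ∂μ))) ∂μ ≤
      ENNReal.ofReal (Real.exp (256 * c ^ 2 * t ^ 2)) := by
  have hc' : (0 : ℝ) < c := hc
  have hX := h.aemeasurable
  have hsq := h.lintegral_exp_sq_le hc
  have hint : Integrable (fun ω => Real.exp (X ω ^ 2 / (4 * c))) μ :=
    (lintegral_ofReal_ne_top_iff_integrable (by fun_prop)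
      (Filter.Eventually.of_forall fun x => (Real.exp_pos _).le)).1
      (ne_top_of_le_ne_top ENNReal.ofReal_ne_top hsq)
  rw [← ofReal_integral_eq_lintegral_ofReal hint
    (Filter.Eventually.of_forall fun x => (Real.exp_pos _).le),
    ENNReal.ofReal_le_ofReal_iff (by positivity)] at hsq
  have hX2 : Integrable (fun ω => X ω ^ 2) μ := (h.memLp 2).integrable_sq
  set m := ∫ ω', X ω' ^ 2 ∂μ
  -- Second-order Taylor: both `y²` and `exp|ty|` are controlled by `exp(y/(8c))`, whose square has
  -- mean at most `√2 ≤ 2`; hence `256 = 2 · 128`.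
  have hpt (ω : Ω) : Real.exp (t * X ω ^ 2) ≤
      1 + t * X ω ^ 2 + 128 * c ^ 2 * t ^ 2 * Real.exp (X ω ^ 2 / (4 * c)) := by
    set y := X ω ^ 2 with hy
    have hy0 : 0 ≤ y := sq_nonneg _
    have h1 := Real.exp_le_one_add_add_sq_mul_exp (t * y)
    have h2 : |t * y| ≤ y / (8 * c) := by
      rw [abs_mul, abs_of_nonneg hy0]
      calc |t| * y ≤ 1 / (8 * c) * y := by gcongr
        _ = _ := by ring
    have h3 : y ^ 2 ≤ 128 * c ^ 2 * Real.exp (y / (8 * c)) := by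
      have := Real.quadratic_le_exp_of_nonneg (x := y / (8 * c)) (by positivity)
      have h4 : (y / (8 * c)) ^ 2 / 2 ≤ Real.exp (y / (8 * c)) := by
        have : 0 ≤ y / (8 * c) := by positivity
        linarith
      have h5 : y ^ 2 = 128 * c ^ 2 * ((y / (8 * c)) ^ 2 / 2) := by field_simp; ring
      rw [h5]; gcongr
    have h6 : Real.exp (y / (4 * c)) = Real.exp (y / (8 * c)) * Real.exp (y / (8 * c)) := by
      rw [← Real.exp_add]; congr 1; field_simp; ring
    calc Real.exp (t * y) ≤ 1 + t * y + (t * y) ^ 2 * Real.exp |t * y| := h1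
      _ ≤ 1 + t * y + t ^ 2 * (128 * c ^ 2 * Real.exp (y / (8 * c))) * Real.exp (y / (8 * c)) := by
          rw [mul_pow]; gcongr
      _ = _ := by rw [h6]; ring
  have hint2 : Integrable (fun ω =>
      1 + t * X ω ^ 2 + 128 * c ^ 2 * t ^ 2 * Real.exp (X ω ^ 2 / (4 * c))) μ :=
    ((integrable_const _).add (hX2.const_mul _)).add (hint.const_mul _)
  have hexp (ω : Ω) : ENNReal.ofReal (Real.exp (t * (X ω ^ 2 - m))) ≤
      ENNReal.ofReal (Real.exp (-(t * m))) * ENNReal.ofReal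
        (1 + t * X ω ^ 2 + 128 * c ^ 2 * t ^ 2 * Real.exp (X ω ^ 2 / (4 * c))) := by
    rw [← ENNReal.ofReal_mul (Real.exp_pos _).le]
    refine ENNReal.ofReal_le_ofReal ?_
    rw [show t * (X ω ^ 2 - m) = -(t * m) + t * X ω ^ 2 by ring, Real.exp_add]
    exact mul_le_mul_of_nonneg_left (hpt ω) (Real.exp_pos _).le
  refine (lintegral_mono hexp).trans ?_
  rw [lintegral_const_mul' _ _ ENNReal.ofReal_ne_top, ← ofReal_integral_eq_lintegral_ofReal hint2
    (Filter.Eventually.of_forall fun ω => (Real.exp_pos _).le.trans (hpt ω)),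
    ← ENNReal.ofReal_mul (Real.exp_pos _).le]
  refine ENNReal.ofReal_le_ofReal ?_
  have hi1 : Integrable (fun ω => 1 + t * X ω ^ 2) μ := (integrable_const _).add (hX2.const_mul _)
  rw [integral_add hi1 (hint.const_mul _), integral_add (integrable_const _) (hX2.const_mul _), integral_const_mul, integral_const_mul]
  simp only [integral_const, probReal_univ, one_smul]
  have hs2 : √2 ≤ 2 := by rw [Real.sqrt_le_left (by norm_num)]; norm_num
  calc Real.exp (-(t * m)) * (1 + t * m + 128 * c ^ 2 * t ^ 2 *
        ∫ ω, Real.exp (X ω ^ 2 / (4 * c)) ∂μ)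
      ≤ Real.exp (-(t * m)) * (1 + t * m + 128 * c ^ 2 * t ^ 2 * 2) := by
        gcongr; exact hsq.trans hs2
    _ ≤ Real.exp (-(t * m)) * Real.exp (t * m + 256 * c ^ 2 * t ^ 2) := by
        gcongr
        have := Real.add_one_le_exp (t * m + 256 * c ^ 2 * t ^ 2)
        linarith
    _ = _ := by rw [← Real.exp_add]; congr 1; ring

end SquareOfSubgaussian

/-! ### Averaging over a ball in place of a net -/

section BallAverage

variable {Ω E : Type*} [MeasurableSpace Ω] {μ : Measure Ω} [SFinite μ]
  [NormedAddCommGroup E] [NormedSpace ℝ E] [FiniteDimensional ℝ E] [MeasurableSpace E]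
  [BorelSpace E]

/-- If each value of `F` is dominated by `G ω` on some ball of radius `r` inside the ball of radius
`R`, then a uniform bound on the integrals of `G · v` bounds the integral of `F`. This replaces a
union bound over a net of the sphere. -/
theorem lintegral_le_of_le_on_ball {F : Ω → ENNReal} {G : Ω → E → ENNReal}
    (hG : Measurable (Function.uncurry G)) {r R : ℝ} (hr : 0 < r) (hR : 0 < R)
    (hF : ∀ ω, ∃ x, Metric.ball x r ⊆ Metric.ball (0 : E) R ∧ ∀ v ∈ Metric.ball x r, F ω ≤ G ω v)
    {M : ENNReal} (hM : ∀ v ∈ Metric.ball (0 : E) R, ∫⁻ ω, G ω v ∂μ ≤ M) :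
    ∫⁻ ω, F ω ∂μ ≤ ENNReal.ofReal ((R / r) ^ Module.finrank ℝ E) * M := by
  let ν : Measure E := Measure.addHaar
  have hν : ν (Metric.ball 0 r) ≠ 0 := (Metric.measure_ball_pos ν 0 hr).ne'
  have hν' : ν (Metric.ball 0 r) ≠ ⊤ := measure_ball_lt_top.ne
  have hpt (ω : Ω) : F ω * ν (Metric.ball 0 r) ≤ ∫⁻ v in Metric.ball 0 R, G ω v ∂ν := by
    obtain ⟨x, hx, hxF⟩ := hF ω
    calc F ω * ν (Metric.ball 0 r) = ∫⁻ _ in Metric.ball x r, F ω ∂ν := by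
          rw [setLIntegral_const, Measure.addHaar_ball_center ν x]
      _ ≤ ∫⁻ v in Metric.ball x r, G ω v ∂ν := setLIntegral_mono' Metric.isOpen_ball.measurableSet hxF
      _ ≤ _ := lintegral_mono_set hx
  have hscale : ν (Metric.ball 0 R) =
      ENNReal.ofReal ((R / r) ^ Module.finrank ℝ E) * ν (Metric.ball 0 r) := by
    have := Measure.addHaar_ball_mul_of_pos ν (0 : E) (div_pos hR hr) r
    rwa [div_mul_cancel₀ _ hr.ne'] at this
  refine (ENNReal.mul_le_mul_iff_left hν hν').1 ?_
  calc (∫⁻ ω, F ω ∂μ) * ν (Metric.ball 0 r) = ∫⁻ ω, F ω * ν (Metric.ball 0 r) ∂μ :=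
        (lintegral_mul_const' _ _ hν').symm
    _ ≤ ∫⁻ ω, ∫⁻ v in Metric.ball 0 R, G ω v ∂ν ∂μ := lintegral_mono hpt
    _ = ∫⁻ v in Metric.ball 0 R, ∫⁻ ω, G ω v ∂μ ∂ν := lintegral_lintegral_swap hG.aemeasurable
    _ ≤ ∫⁻ _ in Metric.ball 0 R, M ∂ν := setLIntegral_mono' Metric.isOpen_ball.measurableSet hM
    _ = _ := by rw [setLIntegral_const, hscale]; ring

end BallAverage

/-! ### Norms controlled by forms on a ball -/

section DeterministicBounds

variable {F : Type*} [NormedAddCommGroup F] [InnerProductSpace ℝ F]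

/-- The centre is the direction of `s`; a displacement of `1/2` costs at most half of the norm. For
`s = 0` the inverse is zero and the bound is trivial. -/
theorem exists_half_norm_le_inner_on_ball (s : F) :
    ∃ x : F, ‖x‖ ≤ 1 ∧ ∀ v ∈ Metric.ball x (1 / 2), ‖s‖ / 2 ≤ inner ℝ v s := by
  refine ⟨‖s‖⁻¹ • s, ?_, fun v hv => ?_⟩
  · rw [norm_smul, norm_inv, norm_norm]
    exact inv_mul_le_one
  · have h1 : inner ℝ (‖s‖⁻¹ • s) s = ‖s‖ := by
      rw [real_inner_smul_left, real_inner_self_eq_norm_sq]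
      rcases eq_or_ne ‖s‖ 0 with h | h
      · simp [h]
      · field_simp
    have h2 : |inner ℝ (v - ‖s‖⁻¹ • s) s| ≤ 1 / 2 * ‖s‖ := by
      refine (abs_real_inner_le_norm _ _).trans ?_
      have : ‖v - ‖s‖⁻¹ • s‖ ≤ 1 / 2 := by rw [← dist_eq_norm]; exact (Metric.mem_ball.1 hv).le
      gcongr
    rw [inner_sub_left, h1] at h2
    have := (abs_le.1 h2).1
    linarith

/-- The quadratic form of a symmetric operator is comparable to its norm on a whole ball of radius
`1 / 4`. -/
theorem ContinuousLinearMap.exists_norm_le_abs_inner_on_ball {T : F →L[ℝ] F}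
    (hT : (T : F →ₗ[ℝ] F).IsSymmetric) :
    ∃ x : F, ‖x‖ ≤ 1 ∧ ∀ v ∈ Metric.ball x (1 / 4), 3 / 8 * ‖T‖ ≤ |inner ℝ (T v) v| := by
  rcases eq_or_ne T 0 with h0 | h0
  · exact ⟨0, by simp, fun v _ => by simp [h0]⟩
  have hpos : 0 < ‖T‖ := norm_pos_iff.2 h0
  -- Moving a near-maximiser by `1/4` costs at most `1/4 + 1/4 + 1/16 = 9/16` of the norm, and
  -- `15/16 - 9/16 = 3/8`.
  obtain ⟨y, hy⟩ : ∃ y, 15 / 16 * ‖T‖ < |T.rayleighQuotient y| := by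
    refine exists_lt_of_lt_ciSup ?_
    rw [← T.norm_eq_iSup_rayleighQuotient hT]
    linarith
  have hy0 : y ≠ 0 := by
    rintro rfl
    simp at hy
    linarith
  have hyn : 0 < ‖y‖ := norm_pos_iff.2 hy0
  set x := ‖y‖⁻¹ • y with hx
  have hx1 : ‖x‖ = 1 := by rw [hx, norm_smul, norm_inv, norm_norm]; field_simp
  have hxq : 15 / 16 * ‖T‖ < |inner ℝ (T x) x| := by
    convert hy using 2
    rw [ContinuousLinearMap.rayleighQuotient, ContinuousLinearMap.reApplyInnerSelf_apply, hx,
      map_smul, real_inner_smul_left, real_inner_smul_right]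
    simp only [RCLike.re_to_real]
    field_simp
  refine ⟨x, hx1.le, fun v hv => ?_⟩
  set h := v - x with hh
  have hn : ‖h‖ ≤ 1 / 4 := by rw [hh, ← dist_eq_norm]; exact (Metric.mem_ball.1 hv).le
  have hv' : v = x + h := by simp [hh]
  have hb : ∀ a b : F, |inner ℝ (T a) b| ≤ ‖T‖ * ‖a‖ * ‖b‖ := fun a b =>
    (abs_real_inner_le_norm _ _).trans (by gcongr; exact T.le_opNorm a)
  have e : inner ℝ (T v) v =
      inner ℝ (T x) x + (inner ℝ (T x) h + inner ℝ (T h) x + inner ℝ (T h) h) := by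
    rw [hv', map_add, inner_add_left, inner_add_right, inner_add_right]; ring
  have b1 : |inner ℝ (T x) h| ≤ ‖T‖ * (1 / 4) := (hb _ _).trans (by rw [hx1, mul_one]; gcongr)
  have b2 : |inner ℝ (T h) x| ≤ ‖T‖ * (1 / 4) := (hb _ _).trans (by rw [hx1, mul_one]; gcongr)
  have b3 : |inner ℝ (T h) h| ≤ ‖T‖ * (1 / 4) * (1 / 4) := (hb _ _).trans (by gcongr)
  have b4 := abs_add_three (inner ℝ (T x) h) (inner ℝ (T h) x) (inner ℝ (T h) h)
  have b5 := abs_sub_abs_le_abs_sub (inner ℝ (T x) x)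
    (-(inner ℝ (T x) h + inner ℝ (T h) x + inner ℝ (T h) h))
  rw [sub_neg_eq_add, abs_neg, ← e] at b5
  linarith

end DeterministicBounds

/-! ### Exponential moments under product measures -/

section ProductMeasure

variable {U : Type*} [MeasurableSpace U] {γ : Measure U} [IsProbabilityMeasure γ]

theorem lintegral_exp_sum_pi {d : ℕ} {g : U → ℝ} (hg : Measurable g) :
    ∫⁻ w, ENNReal.ofReal (Real.exp (∑ k, g (w k))) ∂(Measure.pi fun _ : Fin d => γ) =
      (∫⁻ u, ENNReal.ofReal (Real.exp (g u)) ∂γ) ^ d := by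
  have hG : Measurable fun u => ENNReal.ofReal (Real.exp (g u)) := by fun_prop
  simp_rw [Real.exp_sum, ENNReal.ofReal_prod_of_nonneg fun k _ => (Real.exp_pos _).le]
  rw [lintegral_prod_eq_prod_lintegral_of_indepFun Finset.univ
    (fun k (w : Fin d → U) => ENNReal.ofReal (Real.exp (g (w k))))
    (iIndepFun_pi (μ := fun _ : Fin d => γ) fun _ => hG.aemeasurable)
    fun k => hG.comp (measurable_pi_apply k)]
  have (k : Fin d) : ∫⁻ w, ENNReal.ofReal (Real.exp (g (w k))) ∂(Measure.pi fun _ : Fin d => γ) =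
      ∫⁻ u, ENNReal.ofReal (Real.exp (g u)) ∂γ :=
    (measurePreserving_eval (fun _ : Fin d => γ) k).lintegral_comp hG
  simp [this]

theorem measure_lt_le_of_lintegral_exp_le {μ : Measure U} {F : U → ℝ} (hF : Measurable F) {a : ℝ}
    {b : ENNReal} (h : ∫⁻ u, ENNReal.ofReal (Real.exp (F u)) ∂μ ≤ b) :
    μ {u | a ≤ F u} ≤ b * ENNReal.ofReal (Real.exp (-a)) := by
  have h1 := mul_meas_ge_le_lintegral₀ (μ := μ)
    (f := fun u => ENNReal.ofReal (Real.exp (F u))) (by fun_prop) (ENNReal.ofReal (Real.exp a))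
  have h2 : {u | ENNReal.ofReal (Real.exp a) ≤ ENNReal.ofReal (Real.exp (F u))} =
      {u | a ≤ F u} := by
    ext u
    simp [ENNReal.ofReal_le_ofReal_iff, (Real.exp_pos _).le]
  rw [h2] at h1
  calc μ {u | a ≤ F u}
      = ENNReal.ofReal (Real.exp a) * μ {u | a ≤ F u} * ENNReal.ofReal (Real.exp (-a)) := by
        rw [mul_right_comm, ← ENNReal.ofReal_mul (Real.exp_pos _).le, ← Real.exp_add]
        simp
    _ ≤ _ := by gcongr; exact h1.trans h

omit [IsProbabilityMeasure γ] in
theorem ProbabilityTheory.HasSubgaussianMGF.mono {X : U → ℝ} {c c' : ℝ≥0}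
    (h : HasSubgaussianMGF X c γ) (hc : c ≤ c') : HasSubgaussianMGF X c' γ :=
  ⟨h.integrable_exp_mul, fun t => (h.mgf_le t).trans (by gcongr)⟩

end ProductMeasure

/-! ### Sums and second moments of sub-Gaussian vectors -/

section SubgaussianVectors

variable {U : Type*} [MeasurableSpace U] {γ : Measure U} [IsProbabilityMeasure γ] {n d : ℕ}
  {Z : U → EuclideanSpace ℝ (Fin n)} {c : ℝ≥0}

/-- Balls of radius `1/2` inside the ball of radius `3/2` give `3^n`, and `‖v‖² ≤ 9/4` gives `9/8`.
-/
theorem lintegral_exp_norm_sum_le (hZm : Measurable Z)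
    (hZ : ∀ v, HasSubgaussianMGF (fun u => inner ℝ v (Z u)) (c * ‖v‖₊ ^ 2) γ) (t : ℝ)
    (ht : 0 ≤ t) :
    ∫⁻ w, ENNReal.ofReal (Real.exp (t * (‖∑ k, Z (w k)‖ / 2)))
        ∂(Measure.pi fun _ : Fin d => γ) ≤
      ENNReal.ofReal (3 ^ n) * ENNReal.ofReal (Real.exp (d * (9 / 8 * c * t ^ 2))) := by
  have key := lintegral_le_of_le_on_ball (μ := Measure.pi fun _ : Fin d => γ)
    (F := fun w : Fin d → U => ENNReal.ofReal (Real.exp (t * (‖∑ k, Z (w k)‖ / 2))))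
    (G := fun (w : Fin d → U) (v : EuclideanSpace ℝ (Fin n)) =>
      ENNReal.ofReal (Real.exp (t * inner ℝ v (∑ k, Z (w k)))))
    (r := 1 / 2) (R := 3 / 2) (M := ENNReal.ofReal (Real.exp (d * (9 / 8 * c * t ^ 2))))
    (by simp only [Function.uncurry_def]; fun_prop) (by norm_num) (by norm_num) ?_ ?_
  · refine key.trans_eq ?_
    norm_num [finrank_euclideanSpace]
  · intro w
    obtain ⟨x, hx, hv⟩ := exists_half_norm_le_inner_on_ball (∑ k, Z (w k))
    refine ⟨x, Metric.ball_subset_ball' (by rw [dist_zero_right]; linarith), fun v hvx => ?_⟩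
    gcongr
    exact hv v hvx
  · intro v hv
    have hv' : ‖v‖ ≤ 3 / 2 := (mem_ball_zero_iff.1 hv).le
    have e : ∀ w : Fin d → U, t * inner ℝ v (∑ k, Z (w k)) = ∑ k, t * inner ℝ v (Z (w k)) := by
      intro w; rw [inner_sum, Finset.mul_sum]
    simp_rw [e]
    rw [lintegral_exp_sum_pi (g := fun u => t * inner ℝ v (Z u)) (by fun_prop), Real.exp_nat_mul,
      ENNReal.ofReal_pow (Real.exp_pos _).le]
    refine pow_le_pow_left₀ zero_le (((hZ v).lintegral_exp_mul_le t).trans ?_) d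
    refine ENNReal.ofReal_le_ofReal (Real.exp_le_exp.2 ?_)
    have h2 : ‖v‖ ^ 2 ≤ 9 / 4 := by nlinarith [norm_nonneg v]
    push_cast
    have h3 : 0 ≤ (c : ℝ) * t ^ 2 := by positivity
    nlinarith

/-- Tail bound for the norm of a sum of i.i.d. sub-Gaussian vectors. -/
theorem measure_norm_sum_gt_le (hZm : Measurable Z)
    (hZ : ∀ v, HasSubgaussianMGF (fun u => inner ℝ v (Z u)) (c * ‖v‖₊ ^ 2) γ)
    (hc : 0 < c) (hd : 0 < d) :
    (Measure.pi fun _ : Fin d => γ) {w | 10 * √(c * n * d) ≤ ‖∑ k, Z (w k)‖} ≤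
      ENNReal.ofReal (Real.exp (-2 * n)) := by
  have hc' : (0 : ℝ) < c := hc
  have hd' : (0 : ℝ) < d := by exact_mod_cast hd
  -- With this `t` the moment exponent is `9n/2`, the threshold becomes `10n`, and `3^n ≤ e^{2n}`;
  -- the total `-7n/2` is below `-2n`.
  set t : ℝ := 2 * √(n / (c * d)) with ht
  have htn : 0 ≤ t := by positivity
  have ht2 : d * (9 / 8 * c * t ^ 2) = 9 / 2 * n := by
    rw [ht, mul_pow, Real.sq_sqrt (by positivity)]; field_simp; norm_num
  have hts : t * √(c * n * d) = 2 * n := by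
    rw [ht, mul_assoc, ← Real.sqrt_mul (by positivity)]
    rw [show (n : ℝ) / (c * d) * (c * n * d) = n ^ 2 by field_simp, Real.sqrt_sq (by positivity)]
  have h := measure_lt_le_of_lintegral_exp_le (a := 10 * n)
    (by fun_prop) (lintegral_exp_norm_sum_le (d := d) hZm hZ t htn)
  rw [ht2] at h
  refine (measure_mono ?_).trans (h.trans ?_)
  · intro w hw
    simp only [Set.mem_ofPred_eq] at hw ⊢
    have := mul_le_mul_of_nonneg_left hw htn
    linarith
  · rw [← ENNReal.ofReal_mul (by positivity), ← ENNReal.ofReal_mul (by positivity)]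
    refine ENNReal.ofReal_le_ofReal ?_
    have h3 : (3 : ℝ) ^ n ≤ Real.exp (n * 2) := by
      rw [Real.exp_nat_mul]
      exact pow_le_pow_left₀ (by norm_num) (by linarith [Real.add_one_le_exp (2 : ℝ)]) n
    calc (3 : ℝ) ^ n * Real.exp (9 / 2 * n) * Real.exp (-(10 * n))
        ≤ Real.exp (n * 2) * Real.exp (9 / 2 * n) * Real.exp (-(10 * n)) := by gcongr
      _ ≤ _ := by
        rw [← Real.exp_add, ← Real.exp_add]
        refine Real.exp_le_exp.2 ?_
        have : (0 : ℝ) ≤ n := by positivity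
        linarith

/-- The deviation of the empirical second-moment matrix of the sample `z` from the second-moment
matrix of `Z` under `γ`. -/
noncomputable def secondMomentDeviation (γ : Measure U) (Z : U → EuclideanSpace ℝ (Fin n))
    (z : Fin d → EuclideanSpace ℝ (Fin n)) : Matrix (Fin n) (Fin n) ℝ :=
  (1 / (d : ℝ)) • ∑ k, Matrix.vecMulVec (z k) (z k) - Matrix.of fun i j => ∫ u, Z u i * Z u j ∂γ

omit [IsProbabilityMeasure γ] in
theorem continuous_secondMomentDeviation :
    Continuous fun z : Fin d → EuclideanSpace ℝ (Fin n) => secondMomentDeviation γ Z z := by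
  unfold secondMomentDeviation
  have : ∀ k, Continuous fun z : Fin d → EuclideanSpace ℝ (Fin n) =>
      Matrix.vecMulVec (z k) (z k) := by
    intro k
    exact Continuous.matrix_vecMulVec (by fun_prop) (by fun_prop)
  fun_prop

omit [IsProbabilityMeasure γ] in
theorem isSymm_secondMomentDeviation (z : Fin d → EuclideanSpace ℝ (Fin n)) :
    (secondMomentDeviation γ Z z)ᵀ = secondMomentDeviation γ Z z := by
  ext i j
  simp [secondMomentDeviation, Matrix.sum_apply, Matrix.vecMulVec_apply, mul_comm]

theorem Matrix.isSymmetric_toEuclideanCLM {A : Matrix (Fin n) (Fin n) ℝ} (hA : Aᵀ = A) :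
    (Matrix.toEuclideanCLM (𝕜 := ℝ) A :
      EuclideanSpace ℝ (Fin n) →ₗ[ℝ] EuclideanSpace ℝ (Fin n)).IsSymmetric := by
  intro x y
  rw [ContinuousLinearMap.coe_coe, Matrix.inner_toEuclideanCLM, real_inner_comm,
    Matrix.inner_toEuclideanCLM, Matrix.dotProduct_mulVec, ← Matrix.mulVec_transpose, hA,
    dotProduct_comm]

omit [IsProbabilityMeasure γ] in
theorem dotProduct_secondMoment_mulVec (hZ2 : ∀ i, MemLp (fun u => Z u i) 2 γ)
    (v : EuclideanSpace ℝ (Fin n)) :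
    v.ofLp ⬝ᵥ (Matrix.of fun i j => ∫ u, Z u i * Z u j ∂γ) *ᵥ v.ofLp =
      ∫ u, inner ℝ v (Z u) ^ 2 ∂γ := by
  have hint (i j : Fin n) : Integrable (fun u => v i * v j * (Z u i * Z u j)) γ :=
    ((hZ2 i).integrable_mul (hZ2 j)).const_mul _
  have e (u : U) : inner ℝ v (Z u) ^ 2 = ∑ i, ∑ j, v i * v j * (Z u i * Z u j) := by
    rw [PiLp.inner_apply, sq, Finset.sum_mul_sum]
    refine Finset.sum_congr rfl fun i _ => Finset.sum_congr rfl fun j _ => ?_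
    simp only [RCLike.inner_apply, conj_trivial]
    ring
  simp_rw [e]
  rw [integral_finsetSum _ fun i _ => integrable_finsetSum _ fun j _ => hint i j]
  simp_rw [integral_finsetSum _ fun j _ => hint _ j, integral_const_mul]
  simp only [dotProduct, Matrix.mulVec, Matrix.of_apply, Finset.mul_sum]
  exact Finset.sum_congr rfl fun i _ => Finset.sum_congr rfl fun j _ => by ring

omit [IsProbabilityMeasure γ] in
theorem inner_secondMomentDeviation (hZ2 : ∀ i, MemLp (fun u => Z u i) 2 γ) (hd : 0 < d)
    (z : Fin d → EuclideanSpace ℝ (Fin n)) (v : EuclideanSpace ℝ (Fin n)) :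
    inner ℝ (Matrix.toEuclideanCLM (𝕜 := ℝ) (secondMomentDeviation γ Z z) v) v =
      1 / (d : ℝ) * ∑ k, (inner ℝ v (z k) ^ 2 - ∫ u, inner ℝ v (Z u) ^ 2 ∂γ) := by
  have hd' : (d : ℝ) ≠ 0 := by exact_mod_cast hd.ne'
  have e (k : Fin d) : v.ofLp ⬝ᵥ (Matrix.vecMulVec (z k) (z k)) *ᵥ v.ofLp =
      inner ℝ v (z k) ^ 2 := by
    have h1 : inner ℝ v (z k) = v.ofLp ⬝ᵥ (z k).ofLp := by
      rw [PiLp.inner_apply]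
      exact Finset.sum_congr rfl fun i _ => by simp [mul_comm]
    rw [Matrix.vecMulVec_mulVec, h1, dotProduct_smul, dotProduct_comm (z k).ofLp v.ofLp]
    simp [sq]
  rw [real_inner_comm, Matrix.inner_toEuclideanCLM, secondMomentDeviation, Matrix.sub_mulVec,
    dotProduct_sub, dotProduct_secondMoment_mulVec hZ2, Matrix.smul_mulVec, dotProduct_smul,
    Matrix.sum_mulVec, dotProduct_sum, Finset.sum_sub_distrib, mul_sub]
  simp only [e, smul_eq_mul, Finset.sum_const, Finset.card_univ, Fintype.card_fin, nsmul_eq_mul]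
  field_simp

/-- Here the radii are `1/4` and `5/4`, giving `5^n`; `‖v‖² ≤ 2` turns the proxy into `2c`, whence
`256(2c)² = 1024c²` and the range `t ≤ 1/(16c)`. The factor `2` pays for both signs of the quadratic
form. -/
theorem lintegral_exp_norm_secondMomentDeviation_le (hZm : Measurable Z)
    (hZ : ∀ v, HasSubgaussianMGF (fun u => inner ℝ v (Z u)) (c * ‖v‖₊ ^ 2) γ)
    (hZ2 : ∀ i, MemLp (fun u => Z u i) 2 γ) (hc : 0 < c) (hd : 0 < d) {t : ℝ} (ht : 0 ≤ t)
    (htc : t ≤ 1 / (16 * c)) :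
    ∫⁻ w, ENNReal.ofReal (Real.exp (t * d * (3 / 8 *
        ‖secondMomentDeviation γ Z fun k => Z (w k)‖))) ∂(Measure.pi fun _ : Fin d => γ) ≤
      ENNReal.ofReal (5 ^ n) * (2 * ENNReal.ofReal (Real.exp (d * (1024 * c ^ 2 * t ^ 2)))) := by
  have hc' : (0 : ℝ) < c := hc
  have hd' : (0 : ℝ) < d := by exact_mod_cast hd
  set q : EuclideanSpace ℝ (Fin n) → U → ℝ := fun v u =>
    inner ℝ v (Z u) ^ 2 - ∫ u, inner ℝ v (Z u) ^ 2 ∂γ with hq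
  have hqm (v : EuclideanSpace ℝ (Fin n)) : Measurable (q v) := by fun_prop
  have hqj : Measurable fun p : (Fin d → U) × EuclideanSpace ℝ (Fin n) =>
      ∑ k, q p.2 (p.1 k) := by
    -- As a quadratic form in `v`, the second moment is continuous; this supplies the joint
    -- measurability for Fubini.
    have h1 : Continuous fun v : EuclideanSpace ℝ (Fin n) => ∫ u, inner ℝ v (Z u) ^ 2 ∂γ := by
      simp_rw [← dotProduct_secondMoment_mulVec hZ2, dotProduct, Matrix.mulVec, dotProduct]
      fun_prop
    have h2 : Measurable fun p : (Fin d → U) × EuclideanSpace ℝ (Fin n) =>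
        ∫ u, inner ℝ p.2 (Z u) ^ 2 ∂γ := h1.measurable.comp measurable_snd
    refine Finset.measurable_sum _ fun k _ => Measurable.sub ?_ h2
    fun_prop
  have hexp (s : ℝ) (hs : |s| ≤ 1 / (16 * c)) (v : EuclideanSpace ℝ (Fin n))
      (hv : v ∈ Metric.ball 0 (5 / 4)) :
      ∫⁻ w, ENNReal.ofReal (Real.exp (s * ∑ k, q v (w k))) ∂(Measure.pi fun _ : Fin d => γ) ≤
        ENNReal.ofReal (Real.exp (d * (1024 * c ^ 2 * s ^ 2))) := by
    have hv' : ‖v‖ ≤ 5 / 4 := (mem_ball_zero_iff.1 hv).le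
    have hsub : HasSubgaussianMGF (fun u => inner ℝ v (Z u)) (2 * c) γ := by
      refine (hZ v).mono ?_
      rw [← NNReal.coe_le_coe]
      push_cast
      have : ‖v‖ ^ 2 ≤ 2 := by nlinarith [norm_nonneg v]
      nlinarith
    have h1 := hsub.lintegral_exp_centred_sq_le (t := s) (by positivity)
      (by push_cast; rwa [show 8 * (2 * (c : ℝ)) = 16 * c by ring])
    simp_rw [Finset.mul_sum]
    rw [lintegral_exp_sum_pi (g := fun u => s * q v u) (by fun_prop), Real.exp_nat_mul,
      ENNReal.ofReal_pow (Real.exp_pos _).le]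
    refine pow_le_pow_left₀ zero_le (h1.trans_eq ?_) d
    congr 2
    push_cast
    ring
  have key := lintegral_le_of_le_on_ball (μ := Measure.pi fun _ : Fin d => γ)
    (F := fun w : Fin d → U => ENNReal.ofReal (Real.exp (t * d * (3 / 8 *
        ‖secondMomentDeviation γ Z fun k => Z (w k)‖))))
    (G := fun (w : Fin d → U) (v : EuclideanSpace ℝ (Fin n)) =>
      ENNReal.ofReal (Real.exp (t * ∑ k, q v (w k))) +
        ENNReal.ofReal (Real.exp (-t * ∑ k, q v (w k))))
    (r := 1 / 4) (R := 5 / 4)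
    (M := 2 * ENNReal.ofReal (Real.exp (d * (1024 * c ^ 2 * t ^ 2))))
    (by simp only [Function.uncurry_def]; fun_prop) (by norm_num) (by norm_num) ?_ ?_
  · refine key.trans_eq ?_
    norm_num [finrank_euclideanSpace]
  · intro w
    obtain ⟨x, hx, hv⟩ := ContinuousLinearMap.exists_norm_le_abs_inner_on_ball
      (Matrix.isSymmetric_toEuclideanCLM
        (isSymm_secondMomentDeviation (γ := γ) (Z := Z) fun k => Z (w k)))
    refine ⟨x, Metric.ball_subset_ball' (by rw [dist_zero_right]; linarith), fun v hvx => ?_⟩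
    have h1 := hv v hvx
    rw [Matrix.l2_opNorm_toEuclideanCLM, inner_secondMomentDeviation hZ2 hd, abs_mul,
      abs_of_nonneg (by positivity : 0 ≤ 1 / (d : ℝ))] at h1
    have h2 : t * d * (3 / 8 * ‖secondMomentDeviation γ Z fun k => Z (w k)‖) ≤
        |t * ∑ k, q v (w k)| := by
      rw [abs_mul, abs_of_nonneg ht]
      calc t * d * (3 / 8 * ‖secondMomentDeviation γ Z fun k => Z (w k)‖)
          ≤ t * d * (1 / (d : ℝ) * |∑ k, q v (w k)|) := by gcongr
        _ = _ := by field_simp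
    rw [← ENNReal.ofReal_add (Real.exp_pos _).le (Real.exp_pos _).le]
    refine ENNReal.ofReal_le_ofReal ((Real.exp_le_exp.2 h2).trans ?_)
    rw [neg_mul]
    exact Real.exp_abs_le _
  · intro v hv
    rw [lintegral_add_left (by fun_prop), two_mul]
    have ht' : |t| ≤ 1 / (16 * c) := by rwa [abs_of_nonneg ht]
    refine add_le_add (hexp t ht' v hv) ?_
    have := hexp (-t) (by rwa [abs_neg]) v hv
    rwa [neg_sq] at this

/-- Operator-norm concentration of the empirical second-moment matrix of i.i.d. sub-Gaussian
vectors. -/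
theorem measure_norm_secondMomentDeviation_gt_le (hZm : Measurable Z)
    (hZ : ∀ v, HasSubgaussianMGF (fun u => inner ℝ v (Z u)) (c * ‖v‖₊ ^ 2) γ)
    (hZ2 : ∀ i, MemLp (fun u => Z u i) 2 γ) (hc : 0 < c) (hd : 0 < d) :
    (Measure.pi fun _ : Fin d => γ) {w | 512 * c * (√(n / d) + n / d) ≤
        ‖secondMomentDeviation γ Z fun k => Z (w k)‖} ≤
      ENNReal.ofReal (2 * Real.exp (-2 * n)) := by
  have hc' : (0 : ℝ) < c := hc
  have hd' : (0 : ℝ) < d := by exact_mod_cast hd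
  set s : ℝ := √(n / d) with hs
  have hs0 : 0 ≤ s := Real.sqrt_nonneg _
  have hs2 : s ^ 2 = n / d := Real.sq_sqrt (by positivity)
  have hds : d * s ^ 2 = n := by rw [hs2]; field_simp
  -- The truncation keeps `t` in the sub-exponential range and selects the Gaussian or the linear
  -- regime. The exponents are `4n` from the moment, at most `4n` from `5^n`, and `-12n` from the
  -- threshold.
  set r : ℝ := min 1 s with hr
  have hr0 : 0 ≤ r := le_min zero_le_one hs0
  have hr1 : r ≤ 1 := min_le_left _ _
  have hrs : r ≤ s := min_le_right _ _
  have hrr : s ^ 2 ≤ r * (s + s ^ 2) := by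
    rcases min_cases 1 s with h | h
    · rw [hr, h.1]; linarith
    · rw [hr, h.1]; nlinarith
  set t : ℝ := r / (16 * c) with ht
  have htn : 0 ≤ t := by positivity
  have hmeas : Measurable fun w : Fin d → U => t * d * (3 / 8 *
      ‖secondMomentDeviation γ Z fun k => Z (w k)‖) := by
    have h1 : Measurable fun z : Fin d → EuclideanSpace ℝ (Fin n) =>
        ‖secondMomentDeviation γ Z z‖ := continuous_secondMomentDeviation.norm.measurable
    have h2 : Measurable fun w : Fin d → U => fun k => Z (w k) := by fun_prop
    exact ((h1.comp h2).const_mul _).const_mul _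
  have h := measure_lt_le_of_lintegral_exp_le (a := 12 * n) hmeas
    (lintegral_exp_norm_secondMomentDeviation_le hZm hZ hZ2 hc hd htn
      (by rw [ht]; gcongr))
  refine (measure_mono ?_).trans (h.trans ?_)
  · intro w hw
    simp only [Set.mem_ofPred_eq] at hw ⊢
    rw [← hs2] at hw
    calc (12 * n : ℝ) = 12 * d * s ^ 2 := by rw [← hds]; ring
      _ ≤ 12 * d * (r * (s + s ^ 2)) := by gcongr
      _ = t * d * (3 / 8 * (512 * c * (s + s ^ 2))) := by rw [ht]; field_simp; ring
      _ ≤ _ := by gcongr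
  · have h5 : (5 : ℝ) ^ n ≤ Real.exp (n * 4) := by
      rw [Real.exp_nat_mul]
      exact pow_le_pow_left₀ (by norm_num) (by linarith [Real.add_one_le_exp (4 : ℝ)]) n
    have h6 : d * (1024 * c ^ 2 * t ^ 2) ≤ 4 * (n : ℝ) := by
      calc d * (1024 * c ^ 2 * t ^ 2) = 4 * (d * r ^ 2) := by rw [ht]; field_simp; ring
        _ ≤ 4 * (d * s ^ 2) := by gcongr
        _ = _ := by rw [hds]
    rw [show (2 : ENNReal) = ENNReal.ofReal 2 by simp, ← ENNReal.ofReal_mul (by positivity),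
      ← ENNReal.ofReal_mul (by positivity), ← ENNReal.ofReal_mul (by positivity)]
    refine ENNReal.ofReal_le_ofReal ?_
    calc (5 : ℝ) ^ n * (2 * Real.exp (d * (1024 * c ^ 2 * t ^ 2))) * Real.exp (-(12 * n))
        ≤ Real.exp (n * 4) * (2 * Real.exp (4 * n)) * Real.exp (-(12 * n)) := by gcongr
      _ = 2 * (Real.exp (n * 4) * Real.exp (4 * n) * Real.exp (-(12 * n))) := by ring
      _ ≤ _ := by
        rw [← Real.exp_add, ← Real.exp_add]
        have : (0 : ℝ) ≤ n := by positivity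
        gcongr
        linarith

end SubgaussianVectors

/-! ### Spectral norm estimates -/

section MatrixNorms

variable {m n : ℕ}

theorem Matrix.norm_toLp_vecMul_le (X : Matrix (Fin m) (Fin n) ℝ) (x : EuclideanSpace ℝ (Fin m)) :
    ‖WithLp.toLp 2 (x.ofLp ᵥ* X)‖ ≤ ‖X‖ * ‖x‖ := by
  have h := Matrix.l2_opNorm_mulVec Xᴴ x
  rw [Matrix.l2_opNorm_conjTranspose, Matrix.conjTranspose_eq_transpose_of_trivial,
    Matrix.mulVec_transpose] at h
  exact h

theorem Matrix.norm_vecMulVec_le (a b : EuclideanSpace ℝ (Fin n)) :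
    ‖Matrix.vecMulVec a.ofLp b.ofLp‖ ≤ ‖a‖ * ‖b‖ := by
  rw [← Matrix.l2_opNorm_toEuclideanCLM]
  refine ContinuousLinearMap.opNorm_le_bound _ (by positivity) fun v => ?_
  have h : Matrix.toEuclideanCLM (𝕜 := ℝ) (Matrix.vecMulVec a.ofLp b.ofLp) v = (inner ℝ b v) • a := by
    ext i
    rw [Matrix.ofLp_toEuclideanCLM, Matrix.vecMulVec_mulVec]
    simp only [PiLp.inner_apply, dotProduct, PiLp.smul_apply, RCLike.inner_apply, conj_trivial]
    simp [mul_comm]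
  rw [h, norm_smul, mul_comm ‖a‖, mul_right_comm]
  gcongr
  exact norm_inner_le_norm b v

end MatrixNorms

/-! ### Features of a Gaussian neuron -/

section HiddenFeatures

variable {d₀ d₁ n : ℕ}

/-- The output of a single hidden neuron with weight vector `x`, on all data points. -/
noncomputable def neuronFeature (σ : ℝ → ℝ) (X : Matrix (Fin d₀) (Fin n) ℝ)
    (x : EuclideanSpace ℝ (Fin d₀)) : EuclideanSpace ℝ (Fin n) :=
  WithLp.toLp 2 fun i => σ ((x.ofLp ᵥ* X) i)

/-- The mean of `neuronFeature` under Gaussian weights. -/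
noncomputable def neuronMean (σ : ℝ → ℝ) (X : Matrix (Fin d₀) (Fin n) ℝ) :
    EuclideanSpace ℝ (Fin n) :=
  WithLp.toLp 2 fun i => ∫ x, neuronFeature σ X x i ∂(stdGaussian (EuclideanSpace ℝ (Fin d₀)))

variable {σ : ℝ → ℝ} {L : ℝ≥0} (X : Matrix (Fin d₀) (Fin n) ℝ)

/-- The linear map `x ↦ xᵀX` has norm at most `‖X‖`, and applying `σ` entrywise expands Euclidean
distances by at most `L`. -/
theorem lipschitzWith_neuronFeature (hσ : LipschitzWith L σ) :
    LipschitzWith (L * ‖X‖₊) (neuronFeature σ X) := by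
  refine LipschitzWith.of_dist_le_mul fun x y => ?_
  have h1 : ‖WithLp.toLp 2 ((x - y).ofLp ᵥ* X)‖ ≤ ‖X‖ * ‖x - y‖ :=
    Matrix.norm_toLp_vecMul_le X (x - y)
  have h2 : dist (neuronFeature σ X x) (neuronFeature σ X y) ≤
      L * ‖WithLp.toLp 2 ((x - y).ofLp ᵥ* X)‖ := by
    rw [EuclideanSpace.dist_eq, EuclideanSpace.norm_eq]
    rw [← Real.sqrt_sq L.coe_nonneg, ← Real.sqrt_mul (by positivity), Finset.mul_sum]
    refine Real.sqrt_le_sqrt (Finset.sum_le_sum fun i _ => ?_)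
    rw [← mul_pow]
    refine pow_le_pow_left₀ dist_nonneg ?_ 2
    have := hσ.dist_le_mul ((x.ofLp ᵥ* X) i) ((y.ofLp ᵥ* X) i)
    rw [Real.dist_eq ((x.ofLp ᵥ* X) i)] at this
    simpa [neuronFeature, Matrix.sub_vecMul] using this
  rw [dist_eq_norm x y]
  calc _ ≤ _ := h2
    _ ≤ L * (‖X‖ * ‖x - y‖) := by gcongr
    _ = _ := by push_cast; ring

theorem Real.pi_sq_div_four_le : Real.pi ^ 2 / 4 ≤ (8 / 5) ^ 2 := by
  have := Real.pi_lt_d2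
  have := Real.pi_pos
  nlinarith

theorem LipschitzWith.hasSubgaussianMGF_inner {f : EuclideanSpace ℝ (Fin d₀) →
    EuclideanSpace ℝ (Fin n)} {K : ℝ≥0} (hf : LipschitzWith K f) (v : EuclideanSpace ℝ (Fin n)) :
    HasSubgaussianMGF (fun x => inner ℝ v (f x) -
      ∫ y, inner ℝ v (f y) ∂(stdGaussian (EuclideanSpace ℝ (Fin d₀))))
      ((8 / 5 * K) ^ 2 * ‖v‖₊ ^ 2) (stdGaussian (EuclideanSpace ℝ (Fin d₀))) := by
  have hl : LipschitzWith (‖v‖₊ * K) fun x => inner ℝ v (f x) := by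
    refine LipschitzWith.of_dist_le_mul fun x y => ?_
    rw [Real.dist_eq, ← inner_sub_right]
    refine (abs_real_inner_le_norm _ _).trans ?_
    rw [← dist_eq_norm, NNReal.coe_mul, coe_nnnorm, mul_assoc]
    gcongr
    exact hf.dist_le_mul x y
  refine hl.hasSubgaussianMGF_stdGaussian ?_
  push_cast
  calc Real.pi ^ 2 / 4 * (‖v‖ * K) ^ 2 ≤ (8 / 5) ^ 2 * (‖v‖ * K) ^ 2 := by
        gcongr; exact Real.pi_sq_div_four_le
    _ = _ := by ring

theorem LipschitzWith.integrable_stdGaussian {f : EuclideanSpace ℝ (Fin d₀) → ℝ} {K : ℝ≥0}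
    (hf : LipschitzWith K f) : Integrable f (stdGaussian (EuclideanSpace ℝ (Fin d₀))) := by
  have h := hf.hasSubgaussianMGF_stdGaussian (c := ⟨Real.pi ^ 2 / 4 * (K : ℝ) ^ 2, by positivity⟩)
    le_rfl
  have := h.integrable.add (integrable_const (∫ y, f y ∂(stdGaussian (EuclideanSpace ℝ (Fin d₀)))))
  exact this.congr (Filter.Eventually.of_forall fun x => by simp)

theorem integrable_neuronFeature (hσ : LipschitzWith L σ) (i : Fin n) :
    Integrable (fun x => neuronFeature σ X x i) (stdGaussian (EuclideanSpace ℝ (Fin d₀))) := by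
  have h : LipschitzWith (1 * (L * ‖X‖₊)) fun x => neuronFeature σ X x i :=
    (LipschitzWith.of_dist_le_mul fun x y => by
      rw [NNReal.coe_one, one_mul, dist_eq_norm, dist_eq_norm]
      exact PiLp.norm_apply_le (x - y) i :
      LipschitzWith 1 fun x : EuclideanSpace ℝ (Fin n) => x i).comp (lipschitzWith_neuronFeature X hσ)
  exact h.integrable_stdGaussian

theorem integral_inner_neuronFeature (hσ : LipschitzWith L σ) (v : EuclideanSpace ℝ (Fin n)) :
    ∫ x, inner ℝ v (neuronFeature σ X x) ∂(stdGaussian (EuclideanSpace ℝ (Fin d₀))) =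
      inner ℝ v (neuronMean σ X) := by
  simp only [PiLp.inner_apply, RCLike.inner_apply, conj_trivial, neuronMean]
  rw [integral_finsetSum _ fun i _ => (integrable_neuronFeature X hσ i).mul_const _]
  simp_rw [integral_mul_const]

theorem hasSubgaussianMGF_centred_neuronFeature (hσ : LipschitzWith L σ)
    (v : EuclideanSpace ℝ (Fin n)) :
    HasSubgaussianMGF (fun x => inner ℝ v (neuronFeature σ X x - neuronMean σ X))
      ((8 / 5 * (L * ‖X‖₊)) ^ 2 * ‖v‖₊ ^ 2) (stdGaussian (EuclideanSpace ℝ (Fin d₀))) := by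
  have := (lipschitzWith_neuronFeature X hσ).hasSubgaussianMGF_inner v
  rw [integral_inner_neuronFeature X hσ] at this
  simpa only [inner_sub_right] using this

theorem memLp_centred_neuronFeature (hσ : LipschitzWith L σ) (i : Fin n) :
    MemLp (fun x => (neuronFeature σ X x - neuronMean σ X) i) 2
      (stdGaussian (EuclideanSpace ℝ (Fin d₀))) := by
  have h := (hasSubgaussianMGF_centred_neuronFeature X hσ (EuclideanSpace.single i 1)).memLp 2
  have e (y : EuclideanSpace ℝ (Fin n)) : inner ℝ (EuclideanSpace.single i (1 : ℝ)) y = y i := by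
    rw [EuclideanSpace.inner_single_left]
    simp
  simp_rw [e] at h
  exact h

theorem integral_abs_gaussianReal_le : ∫ ξ, |ξ| ∂(gaussianReal 0 1) ≤ 1 := by
  have h2 : Integrable (fun ξ : ℝ => ξ ^ 2) (gaussianReal 0 1) :=
    (memLp_id_gaussianReal (μ := 0) (v := 1) 2).integrable_sq
  have hv : ∫ ξ : ℝ, ξ ^ 2 ∂(gaussianReal 0 1) = 1 := by
    have := variance_id_gaussianReal (μ := 0) (v := 1)
    rw [variance_eq_integral (by fun_prop)] at this
    simpa using this
  calc ∫ ξ, |ξ| ∂(gaussianReal 0 1) ≤ ∫ ξ : ℝ, (1 / 2 + 1 / 2 * ξ ^ 2) ∂(gaussianReal 0 1) := by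
        refine integral_mono_of_nonneg (Filter.Eventually.of_forall fun ξ => abs_nonneg ξ)
          ((integrable_const _).add (h2.const_mul _)) (Filter.Eventually.of_forall fun ξ => ?_)
        simp only
        nlinarith [sq_nonneg (|ξ| - 1), sq_abs ξ]
    _ = 1 := by
        rw [integral_add (integrable_const _) (h2.const_mul _), integral_const_mul, hv]
        simp; norm_num

/-- Subtracting `E σ(ξ) = 0` leaves increments of size `L|s-1||ξ|`, and `E|ξ| ≤ 1`. For `s ≥ 0` the
factor `s + 1 ≥ 1` upgrades `|s-1|` to `|s²-1|`, the quantity that `B` controls. -/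
theorem abs_integral_comp_mul_le (hσ : LipschitzWith L σ)
    (hσ0 : ∫ ξ, σ ξ ∂(gaussianReal 0 1) = 0) {s : ℝ} (hs : 0 ≤ s) :
    |∫ ξ, σ (s * ξ) ∂(gaussianReal 0 1)| ≤ L * |s ^ 2 - 1| := by
  have habs : Integrable (fun ξ : ℝ => |ξ|) (gaussianReal 0 1) :=
    (memLp_id_gaussianReal (μ := 0) (v := 1) 1).integrable (by simp) |>.abs
  have hint (r : ℝ) : Integrable (fun ξ => σ (r * ξ)) (gaussianReal 0 1) := by
    refine Integrable.mono' ((integrable_const |σ 0|).add (habs.const_mul (L * |r|)))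
      (hσ.continuous.comp (by fun_prop)).aestronglyMeasurable
      (Filter.Eventually.of_forall fun ξ => ?_)
    have := hσ.dist_le_mul (r * ξ) 0
    rw [Real.dist_eq, Real.dist_eq, sub_zero, abs_mul] at this
    have h3 := abs_sub_abs_le_abs_sub (σ (r * ξ)) (σ 0)
    simp only [Pi.add_apply, Real.norm_eq_abs]
    linarith
  have h1 : ∫ ξ, σ (s * ξ) ∂(gaussianReal 0 1) =
      ∫ ξ, (σ (s * ξ) - σ ξ) ∂(gaussianReal 0 1) := by
    rw [integral_sub (hint s) (by simpa using hint 1), hσ0, sub_zero]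
  rw [h1, ← Real.norm_eq_abs]
  have h2 : ‖∫ ξ, (σ (s * ξ) - σ ξ) ∂(gaussianReal 0 1)‖ ≤
      ∫ ξ, (L * |s - 1|) * |ξ| ∂(gaussianReal 0 1) := by
    refine norm_integral_le_of_norm_le (habs.const_mul _) (Filter.Eventually.of_forall fun ξ => ?_)
    have := hσ.dist_le_mul (s * ξ) ξ
    rw [Real.dist_eq, Real.dist_eq, show s * ξ - ξ = (s - 1) * ξ by ring, abs_mul] at this
    rw [Real.norm_eq_abs]
    linarith
  refine h2.trans ?_
  rw [integral_const_mul]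
  have h3 : |s - 1| ≤ |s ^ 2 - 1| := by
    rw [show s ^ 2 - 1 = (s - 1) * (s + 1) by ring, abs_mul, abs_of_nonneg (by linarith : 0 ≤ s + 1)]
    nlinarith [abs_nonneg (s - 1)]
  calc (L : ℝ) * |s - 1| * ∫ ξ, |ξ| ∂(gaussianReal 0 1) ≤ L * |s - 1| * 1 := by
        gcongr; exact integral_abs_gaussianReal_le
    _ ≤ _ := by rw [mul_one]; gcongr

/-- The pre-activation at a data point is a linear functional of a Gaussian vector, hence centred
normal with standard deviation the column norm. -/
theorem neuronMean_apply_eq (hσ : Continuous σ) (i : Fin n) :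
    neuronMean σ X i = ∫ ξ, σ (colNorm X i * ξ) ∂(gaussianReal 0 1) := by
  set ℓ : StrongDual ℝ (EuclideanSpace ℝ (Fin d₀)) := innerSL ℝ (WithLp.toLp 2 (X.col i)) with hℓ
  have hn : ‖ℓ‖ = colNorm X i := by rw [hℓ, innerSL_apply_norm, colNorm]
  have hmap := IsGaussian.map_eq_gaussianReal (μ := stdGaussian (EuclideanSpace ℝ (Fin d₀))) ℓ
  rw [integral_strongDual_stdGaussian, variance_dual_stdGaussian, hn] at hmap
  have hmap2 := gaussianReal_map_const_mul (μ := 0) (v := 1) (colNorm X i)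
  have e : (gaussianReal 0 1).map (fun x => colNorm X i * x) =
      (stdGaussian (EuclideanSpace ℝ (Fin d₀))).map ℓ := by
    rw [hmap2, hmap, mul_zero, mul_one]
    congr 1
    ext
    simp [Real.coe_toNNReal _ (sq_nonneg _)]
  calc neuronMean σ X i
      = ∫ x, σ (ℓ x) ∂(stdGaussian (EuclideanSpace ℝ (Fin d₀))) := by
        simp only [neuronMean, neuronFeature, hℓ, innerSL_apply_apply, PiLp.inner_apply,
          Matrix.vecMul, dotProduct, RCLike.inner_apply, conj_trivial]
        rfl
    _ = ∫ y, σ y ∂((stdGaussian (EuclideanSpace ℝ (Fin d₀))).map ℓ) := by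
        rw [integral_map (by fun_prop) hσ.aestronglyMeasurable]
    _ = _ := by rw [← e, integral_map (by fun_prop) hσ.aestronglyMeasurable]

theorem norm_neuronMean_le (hσ : LipschitzWith L σ) (hσ0 : ∫ ξ, σ ξ ∂(gaussianReal 0 1) = 0)
    {B : ℝ} (hB : 0 ≤ B) (hX : ∑ i, (colNorm X i ^ 2 - 1) ^ 2 ≤ B ^ 2) :
    ‖neuronMean σ X‖ ≤ L * B := by
  rw [EuclideanSpace.norm_eq]
  refine Real.sqrt_le_iff.2 ⟨by positivity, ?_⟩
  calc ∑ i, ‖neuronMean σ X i‖ ^ 2 ≤ ∑ i, (L : ℝ) ^ 2 * (colNorm X i ^ 2 - 1) ^ 2 := by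
        refine Finset.sum_le_sum fun i _ => ?_
        rw [← sq_abs (colNorm X i ^ 2 - 1), ← mul_pow, neuronMean_apply_eq X hσ.continuous,
          Real.norm_eq_abs]
        exact pow_le_pow_left₀ (abs_nonneg _)
          (abs_integral_comp_mul_le hσ hσ0 (norm_nonneg _)) 2
    _ ≤ _ := by rw [← Finset.mul_sum, mul_pow]; gcongr

theorem expectedCK_apply (hσ : Continuous σ) (i j : Fin n) :
    expectedCK σ X i j = ∫ x, neuronFeature σ X x i * neuronFeature σ X x j
      ∂(stdGaussian (EuclideanSpace ℝ (Fin d₀))) := by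
  rw [← map_pi_eq_stdGaussian, integral_map (by fun_prop) ?_]
  · rfl
  · have : Continuous fun x : EuclideanSpace ℝ (Fin d₀) =>
        neuronFeature σ X x i * neuronFeature σ X x j := by
      simp only [neuronFeature, Matrix.vecMul, dotProduct]
      fun_prop
    exact this.aestronglyMeasurable

/-- Splitting off the mean of the features: the deviation of the empirical kernel is the deviation
of the empirical covariance plus a cross term. -/
theorem empiricalCK_sub_expectedCK (hσ : LipschitzWith L σ) (hd : 0 < d₁)
    (W : Matrix (Fin d₁) (Fin d₀) ℝ) :
    empiricalCK σ W X - expectedCK σ X =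
      secondMomentDeviation (stdGaussian (EuclideanSpace ℝ (Fin d₀)))
        (fun x => neuronFeature σ X x - neuronMean σ X)
        (fun k => neuronFeature σ X (WithLp.toLp 2 (W k)) - neuronMean σ X) +
      (1 / (d₁ : ℝ)) • (Matrix.vecMulVec (neuronMean σ X).ofLp
          (∑ k, (neuronFeature σ X (WithLp.toLp 2 (W k)) - neuronMean σ X)).ofLp +
        Matrix.vecMulVec (∑ k, (neuronFeature σ X (WithLp.toLp 2 (W k)) - neuronMean σ X)).ofLp
          (neuronMean σ X).ofLp) := by
  have hd' : (d₁ : ℝ) ≠ 0 := by exact_mod_cast hd.ne'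
  ext i j
  set m := neuronMean σ X with hm
  have hmi (i : Fin n) : ∫ x, (neuronFeature σ X x - m) i
      ∂(stdGaussian (EuclideanSpace ℝ (Fin d₀))) = 0 := by
    simp only [PiLp.sub_apply]
    rw [integral_sub (integrable_neuronFeature X hσ i) (integrable_const _)]
    simp [hm, neuronMean]
  have hZ (i : Fin n) := memLp_centred_neuronFeature X hσ i
  rw [← hm] at hZ
  -- In expectation the cross terms vanish because `Z` is centred; in the empirical sum they
  -- survive.
  have hcov : expectedCK σ X i j = ∫ x, (neuronFeature σ X x - m) i * (neuronFeature σ X x - m) j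
      ∂(stdGaussian (EuclideanSpace ℝ (Fin d₀))) + m i * m j := by
    rw [expectedCK_apply X hσ.continuous]
    have e (x : EuclideanSpace ℝ (Fin d₀)) : neuronFeature σ X x i * neuronFeature σ X x j =
        (neuronFeature σ X x - m) i * (neuronFeature σ X x - m) j +
          (m i * (neuronFeature σ X x - m) j + ((neuronFeature σ X x - m) i * m j + m i * m j)) := by
      simp only [PiLp.sub_apply]; ring
    have i1 : Integrable (fun x => (neuronFeature σ X x - m) i * (neuronFeature σ X x - m) j)
      (stdGaussian (EuclideanSpace ℝ (Fin d₀))) := (hZ i).integrable_mul (hZ j)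
    have i2 := ((hZ j).integrable (by simp)).const_mul (m i)
    have i3 := ((hZ i).integrable (by simp)).mul_const (m j)
    have i4 : Integrable (fun _ => m i * m j) (stdGaussian (EuclideanSpace ℝ (Fin d₀))) :=
      integrable_const _
    have i34 : Integrable (fun x => (neuronFeature σ X x - m) i * m j + m i * m j)
      (stdGaussian (EuclideanSpace ℝ (Fin d₀))) := i3.add i4
    have i234 : Integrable (fun x => m i * (neuronFeature σ X x - m) j +
        ((neuronFeature σ X x - m) i * m j + m i * m j))
      (stdGaussian (EuclideanSpace ℝ (Fin d₀))) := i2.add i34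
    simp_rw [e]
    rw [integral_add i1 i234, integral_add i2 i34, integral_add i3 i4,
      integral_const_mul, integral_mul_const, hmi, hmi]
    simp
  have hemp : empiricalCK σ W X i j = 1 / (d₁ : ℝ) * ∑ k,
      neuronFeature σ X (WithLp.toLp 2 (W k)) i * neuronFeature σ X (WithLp.toLp 2 (W k)) j := rfl
  rw [Matrix.sub_apply, hemp, hcov]
  simp only [secondMomentDeviation, Matrix.add_apply, Matrix.sub_apply, Matrix.smul_apply,
    Matrix.sum_apply, Matrix.vecMulVec_apply, Matrix.of_apply, smul_eq_mul, WithLp.ofLp_sum,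
    Finset.sum_apply]
  have e2 : ∑ k, neuronFeature σ X (WithLp.toLp 2 (W k)) i *
        neuronFeature σ X (WithLp.toLp 2 (W k)) j =
      ∑ k, (neuronFeature σ X (WithLp.toLp 2 (W k)) - m) i *
        (neuronFeature σ X (WithLp.toLp 2 (W k)) - m) j +
      (m i * ∑ k, (neuronFeature σ X (WithLp.toLp 2 (W k)) - m) j +
        (∑ k, (neuronFeature σ X (WithLp.toLp 2 (W k)) - m) i) * m j) + d₁ * (m i * m j) := by
    rw [Finset.mul_sum, Finset.sum_mul, ← Finset.sum_add_distrib, ← Finset.sum_add_distrib]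
    have : (d₁ : ℝ) * (m i * m j) = ∑ _k : Fin d₁, m i * m j := by simp
    rw [this, ← Finset.sum_add_distrib]
    refine Finset.sum_congr rfl fun k _ => ?_
    simp only [PiLp.sub_apply]
    ring
  rw [e2]
  field_simp
  ring

theorem norm_empiricalCK_sub_expectedCK_le (hσ : LipschitzWith L σ) (hd : 0 < d₁)
    (W : Matrix (Fin d₁) (Fin d₀) ℝ) :
    ‖empiricalCK σ W X - expectedCK σ X‖ ≤
      ‖secondMomentDeviation (stdGaussian (EuclideanSpace ℝ (Fin d₀)))
        (fun x => neuronFeature σ X x - neuronMean σ X)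
        (fun k => neuronFeature σ X (WithLp.toLp 2 (W k)) - neuronMean σ X)‖ +
      2 / d₁ * ‖neuronMean σ X‖ *
        ‖∑ k, (neuronFeature σ X (WithLp.toLp 2 (W k)) - neuronMean σ X)‖ := by
  rw [empiricalCK_sub_expectedCK X hσ hd]
  refine (norm_add_le _ _).trans (add_le_add_right ?_ _)
  rw [norm_smul, Real.norm_of_nonneg (by positivity)]
  set S := ∑ k, (neuronFeature σ X (WithLp.toLp 2 (W k)) - neuronMean σ X)
  calc _ ≤ 1 / (d₁ : ℝ) * (‖neuronMean σ X‖ * ‖S‖ + ‖S‖ * ‖neuronMean σ X‖) := by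
        gcongr
        exact (norm_add_le _ _).trans
          (add_le_add (Matrix.norm_vecMulVec_le _ _) (Matrix.norm_vecMulVec_le _ _))
    _ = _ := by ring

theorem IsGaussianWeights.aemeasurable_rows {Ω : Type*} [MeasurableSpace Ω] {P : Measure Ω}
    {W : Ω → Matrix (Fin d₁) (Fin d₀) ℝ} (hW : IsGaussianWeights P W) :
    AEMeasurable (fun ω k => (WithLp.toLp 2 (W ω k) : EuclideanSpace ℝ (Fin d₀))) P := by
  refine aemeasurable_pi_lambda _ fun k => ?_
  have h : AEMeasurable (fun ω j => W ω k j) P :=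
    aemeasurable_pi_lambda _ fun j => (hW.1 k j).aemeasurable
  exact (by fun_prop : Measurable fun x : Fin d₀ → ℝ =>
    (WithLp.toLp 2 x : EuclideanSpace ℝ (Fin d₀))).comp_aemeasurable h

/-- The rows of a Gaussian weight matrix are i.i.d. standard Gaussian vectors. -/
theorem IsGaussianWeights.map_rows {Ω : Type*} [MeasurableSpace Ω] {P : Measure Ω}
    {W : Ω → Matrix (Fin d₁) (Fin d₀) ℝ} (hW : IsGaussianWeights P W) :
    P.map (fun ω k => (WithLp.toLp 2 (W ω k) : EuclideanSpace ℝ (Fin d₀))) =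
      Measure.pi fun _ => stdGaussian (EuclideanSpace ℝ (Fin d₀)) := by
  have hae (p : Fin d₁ × Fin d₀) : AEMeasurable (fun ω => W ω p.1 p.2) P :=
    (hW.1 p.1 p.2).aemeasurable
  have h1 := hW.2.map_fun_eq_pi_map hae
  have h2 (p : Fin d₁ × Fin d₀) : P.map (fun ω => W ω p.1 p.2) = gaussianReal 0 1 :=
    (hW.1 p.1 p.2).map_eq
  simp_rw [h2] at h1
  -- Currying turns the product law over index pairs into a product over rows of products over
  -- entries.
  have h3 := Measure.infinitePi_map_curry (fun (_ : Fin d₁) (_ : Fin d₀) => gaussianReal 0 1)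
  simp_rw [Measure.infinitePi_eq_pi] at h3
  have h4 := Measure.pi_map_pi (μ := fun _ : Fin d₁ => Measure.pi fun _ : Fin d₀ => gaussianReal 0 1)
    (f := fun _ x => (WithLp.toLp 2 x : EuclideanSpace ℝ (Fin d₀))) (fun _ => by fun_prop)
  simp_rw [map_pi_eq_stdGaussian] at h4
  have h5 : Measurable fun (x : Fin d₁ → Fin d₀ → ℝ) k =>
      (WithLp.toLp 2 (x k) : EuclideanSpace ℝ (Fin d₀)) :=
    measurable_pi_lambda _ fun k => (by fun_prop : Measurable fun x : Fin d₀ → ℝ =>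
      (WithLp.toLp 2 x : EuclideanSpace ℝ (Fin d₀))).comp (measurable_pi_apply k)
  rw [← h4, ← h3, ← h1, AEMeasurable.map_map_of_aemeasurable (by fun_prop)
    (aemeasurable_pi_lambda _ hae), AEMeasurable.map_map_of_aemeasurable h5.aemeasurable
    ((MeasurableEquiv.measurable _).comp_aemeasurable (aemeasurable_pi_lambda _ hae))]
  rfl

end HiddenFeatures

/-! ### Union bound and conclusion -/

theorem measure_norm_empiricalCK_sub_expectedCK_gt_le {d₀ d₁ n : ℕ} (hd : 0 < d₁)
    (X : Matrix (Fin d₀) (Fin n) ℝ) {B : ℝ} (hB : 0 ≤ B)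
    (hXB : ∑ i, (colNorm X i ^ 2 - 1) ^ 2 ≤ B ^ 2) {σ : ℝ → ℝ} {L : ℝ≥0} (hσ : LipschitzWith L σ)
    (hσ0 : ∫ ξ, σ ξ ∂(gaussianReal 0 1) = 0) {Ω : Type*} [MeasurableSpace Ω] {P : Measure Ω}
    {W : Ω → Matrix (Fin d₁) (Fin d₀) ℝ} (hW : IsGaussianWeights P W) :
    P {ω | ‖empiricalCK σ (W ω) X - expectedCK σ X‖ ≤
        1311 * (Real.sqrt ((n : ℝ) / d₁) + (n : ℝ) / d₁) * (L : ℝ) ^ 2 * ‖X‖ ^ 2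
          + 32 * B * (L : ℝ) ^ 2 * ‖X‖ * Real.sqrt ((n : ℝ) / d₁)}ᶜ ≤
      ENNReal.ofReal (4 * Real.exp (-2 * n)) := by
  have hd' : (0 : ℝ) < d₁ := by exact_mod_cast hd
  have hm := norm_neuronMean_le X hσ hσ0 hB hXB
  set R : ℝ := 1311 * (Real.sqrt ((n : ℝ) / d₁) + (n : ℝ) / d₁) * (L : ℝ) ^ 2 * ‖X‖ ^ 2
          + 32 * B * (L : ℝ) ^ 2 * ‖X‖ * Real.sqrt ((n : ℝ) / d₁) with hR
  set Z : EuclideanSpace ℝ (Fin d₀) → EuclideanSpace ℝ (Fin n) :=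
    fun x => neuronFeature σ X x - neuronMean σ X with hZdef
  have hZlip := lipschitzWith_neuronFeature X hσ
  -- The tail bounds need `c > 0`. If `L‖X‖ = 0` the feature is constant, so `Z = 0` and the
  -- deviation vanishes surely.
  rcases eq_or_ne (L * ‖X‖₊) 0 with h0 | h0
  · have hconst (x : EuclideanSpace ℝ (Fin d₀)) : Z x = 0 := by
      have h (x y : EuclideanSpace ℝ (Fin d₀)) : neuronFeature σ X x = neuronFeature σ X y := by
        have := hZlip.dist_le_mul x y
        rw [h0, NNReal.coe_zero, zero_mul] at this
        exact dist_le_zero.1 this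
      ext i
      simp only [hZdef, PiLp.sub_apply, PiLp.zero_apply, neuronMean]
      simp_rw [fun y => h y x]
      simp
    have hall (w : Matrix (Fin d₁) (Fin d₀) ℝ) : ‖empiricalCK σ w X - expectedCK σ X‖ ≤ R := by
      refine (norm_empiricalCK_sub_expectedCK_le X hσ hd w).trans ?_
      have h1 : secondMomentDeviation (stdGaussian (EuclideanSpace ℝ (Fin d₀))) Z
          (fun k => Z (WithLp.toLp 2 (w k))) = 0 := by
        ext i j
        simp [secondMomentDeviation, hconst]
      change ‖secondMomentDeviation (stdGaussian (EuclideanSpace ℝ (Fin d₀))) Z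
          (fun k => Z (WithLp.toLp 2 (w k)))‖ +
        2 / d₁ * ‖neuronMean σ X‖ * ‖∑ k, Z (WithLp.toLp 2 (w k))‖ ≤ R
      rw [h1]
      simp only [hconst, norm_zero, Finset.sum_const_zero, mul_zero, add_zero]
      positivity
    simp [hall]
  set c : ℝ≥0 := (8 / 5 * (L * ‖X‖₊)) ^ 2 with hc
  have hcpos : 0 < c := by
    have : 0 < L * ‖X‖₊ := pos_iff_ne_zero.2 h0
    positivity
  have hcr : (c : ℝ) = 64 / 25 * ((L : ℝ) ^ 2 * ‖X‖ ^ 2) := by rw [hc]; push_cast; ring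
  have hZm : Measurable Z := (hZlip.continuous.sub continuous_const).measurable
  have hZsub (v : EuclideanSpace ℝ (Fin n)) :=
    hasSubgaussianMGF_centred_neuronFeature X hσ v
  have hS := measure_norm_sum_gt_le (d := d₁) hZm hZsub hcpos hd
  have hA := measure_norm_secondMomentDeviation_gt_le (d := d₁) hZm hZsub
    (memLp_centred_neuronFeature X hσ) hcpos hd
  set row : Ω → Fin d₁ → EuclideanSpace ℝ (Fin d₀) := fun ω k => WithLp.toLp 2 (W ω k) with hrow
  set S₁ : Set (Fin d₁ → EuclideanSpace ℝ (Fin d₀)) :=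
    {w | 10 * √(c * n * d₁) ≤ ‖∑ k, Z (w k)‖}
  set S₂ : Set (Fin d₁ → EuclideanSpace ℝ (Fin d₀)) :=
    {w | 512 * c * (√(n / d₁) + n / d₁) ≤
      ‖secondMomentDeviation (stdGaussian (EuclideanSpace ℝ (Fin d₀))) Z fun k => Z (w k)‖}
  have hsub : {ω | ‖empiricalCK σ (W ω) X - expectedCK σ X‖ ≤ R}ᶜ ⊆ row ⁻¹' (S₁ ∪ S₂) := by
    intro ω hω
    by_contra hcon
    simp only [S₁, S₂, Set.mem_preimage, Set.mem_union, Set.mem_ofPred_eq, not_or, not_le] at hcon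
    refine hω ((norm_empiricalCK_sub_expectedCK_le X hσ hd (W ω)).trans ?_)
    have hsq : √(c * n * d₁) = 8 / 5 * (L * ‖X‖) * (d₁ * √(n / d₁)) := by
      rw [← Real.sqrt_sq (by positivity : 0 ≤ 8 / 5 * (L * ‖X‖) * (d₁ * √((n : ℝ) / d₁)))]
      congr 1
      rw [mul_pow, mul_pow (d₁ : ℝ), Real.sq_sqrt (by positivity), hcr]
      field_simp
      ring
    calc _ ≤ 512 * c * (√(n / d₁) + n / d₁) + 2 / d₁ * (L * B) * (10 * √(c * n * d₁)) := by
          gcongr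
          · exact hcon.2.le
          · exact hcon.1.le
      _ ≤ R := by
          rw [hsq, hcr, hR]
          have h1 : 2 / d₁ * (L * B) * (10 * (8 / 5 * (L * ‖X‖) * (d₁ * √(n / d₁)))) =
              32 * B * (L : ℝ) ^ 2 * ‖X‖ * √(n / d₁) := by
            field_simp; ring
          rw [h1]
          gcongr ?_ + _
          have h2 : 0 ≤ (√(n / d₁) + n / d₁) * ((L : ℝ) ^ 2 * ‖X‖ ^ 2) := by positivity
          linarith
  calc P {ω | ‖empiricalCK σ (W ω) X - expectedCK σ X‖ ≤ R}ᶜ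
      ≤ P (row ⁻¹' (S₁ ∪ S₂)) := measure_mono hsub
    -- This inequality holds for arbitrary sets, so measurability of the bad events is not needed.
    _ ≤ (P.map row) (S₁ ∪ S₂) := Measure.le_map_apply hW.aemeasurable_rows _
    _ ≤ (P.map row) S₁ + (P.map row) S₂ := measure_union_le _ _
    _ ≤ ENNReal.ofReal (Real.exp (-2 * n)) + ENNReal.ofReal (2 * Real.exp (-2 * n)) := by
        rw [hW.map_rows]; exact add_le_add hS hA
    _ ≤ _ := by
        rw [← ENNReal.ofReal_add (by positivity) (by positivity)]
        refine ENNReal.ofReal_le_ofReal ?_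
        have := Real.exp_pos (-2 * (n : ℝ))
        linarith

theorem mainTheorem5 :
    ∃ C : ℝ, 0 < C ∧
      ∀ (d₀ d₁ n : ℕ), 0 < d₁ →
      ∀ (X : Matrix (Fin d₀) (Fin n) ℝ) (B : ℝ), 0 ≤ B →
        ∑ i, (colNorm X i ^ 2 - 1) ^ 2 ≤ B ^ 2 →
      ∀ (σ : ℝ → ℝ) (L : ℝ≥0), LipschitzWith L σ →
        ∫ ξ, σ ξ ∂(gaussianReal 0 1) = 0 →
      ∀ (Ω : Type*) [MeasurableSpace Ω] (P : Measure Ω) [IsProbabilityMeasure P]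
        (W : Ω → Matrix (Fin d₁) (Fin d₀) ℝ), IsGaussianWeights P W →
        1 - 4 * Real.exp (-2 * (n : ℝ)) ≤
          P.real {ω | ‖empiricalCK σ (W ω) X - expectedCK σ X‖ ≤
            C * (Real.sqrt ((n : ℝ) / d₁) + (n : ℝ) / d₁) * (L : ℝ) ^ 2 * ‖X‖ ^ 2
              + 32 * B * (L : ℝ) ^ 2 * ‖X‖ * Real.sqrt ((n : ℝ) / d₁)} := by
  refine ⟨1311, by norm_num, ?_⟩
  intro d₀ d₁ n hd X B hB hXB σ L hσ hσ0 Ω _ P _ W hW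
  have h := measure_norm_empiricalCK_sub_expectedCK_gt_le hd X hB hXB hσ hσ0 hW
  set G : Set Ω := {ω | ‖empiricalCK σ (W ω) X - expectedCK σ X‖ ≤
      1311 * (Real.sqrt ((n : ℝ) / d₁) + (n : ℝ) / d₁) * (L : ℝ) ^ 2 * ‖X‖ ^ 2
        + 32 * B * (L : ℝ) ^ 2 * ‖X‖ * Real.sqrt ((n : ℝ) / d₁)}
  have h1 : P.real Gᶜ ≤ 4 * Real.exp (-2 * n) := ENNReal.toReal_le_of_le_ofReal (by positivity) h
  -- Subadditivity suffices here, so `G` need not be shown measurable.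
  have h2 : P.real (G ∪ Gᶜ) ≤ P.real G + P.real Gᶜ := measureReal_union_le _ _
  rw [Set.union_compl_self, probReal_univ] at h2
  linarith
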